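/- Let $\mathbb S^3=\{(z,w)\in\mathbb C^2 : |z|^2+|w|^2=2\}$, with $\mathbb C^2=\mathbb R^4$, and identify $\mathbb S^3/(-1)$ with $\mathbb{RP}^3=(\mathbb R^4\setminus 0)/\mathbb R^\times$. For integers $p,q$ with $p\equiv q \pmod 2$ and $(p,q)\ne(0,0)$, let the projective torus link $T_{\mathrm{proj}}(p,q)\subset\mathbb{RP}^3$ be the image of $\{(z,w)\in\mathbb S^3 : z^p=w^q\}$, where $z^p$ is replaced by $\bar z^{|p|}$ if $p<0$, and $w^q$ by $\bar w^{|q|}$ if $q<0$. For a link $L$ (a compact smooth one-dimensional submanifold) in $\mathbb{RP}^3$, let the plane section number $\operatorname{ps}(L)$ be the smallest number of points of $L'\cap P$, where $L'$ runs over the links smoothly ambient isotopic to $L$ and $P$ over the projective planes transverse to $L'$. Then $$\operatorname{ps}(T_{\mathrm{proj}}(p,q))=\min(|p|,|q|).$$ In particular, $\operatorname{ps}(T_{\mathrm{proj}}(p,q))=q$ if $1\le q\le p$ and $p\equiv q\pmod 2$. -/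

import Mathlib

open scoped LinearAlgebra.Projectivization Manifold ContDiff

noncomputable section

/-! ### Real projective space as a smooth manifold -/

/-- Real projective `n`-space: the set of lines through the origin of `ℝⁿ⁺¹`. -/
def RealProj (n : ℕ) : Type := ℙ ℝ (EuclideanSpace ℝ (Fin (n + 1)))

namespace RealProj

variable {n : ℕ}

/-- The point `(v₀ : … : vₙ)` with homogeneous coordinates `v`. -/
def mk (v : {v : EuclideanSpace ℝ (Fin (n + 1)) // v ≠ 0}) : RealProj n :=
  Projectivization.mk ℝ v.1 v.2

/-- A vector of homogeneous coordinates of a point. -/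
def rep (x : RealProj n) : EuclideanSpace ℝ (Fin (n + 1)) := Projectivization.rep x

/-- The quotient topology from `ℝⁿ⁺¹ ∖ 0`. -/
instance : TopologicalSpace (RealProj n) := TopologicalSpace.coinduced mk inferInstance

theorem rep_ne_zero (x : RealProj n) : x.rep ≠ 0 := Projectivization.rep_nonzero x

theorem mk_rep (x : RealProj n) : mk ⟨x.rep, x.rep_ne_zero⟩ = x := Projectivization.mk_rep x

theorem mk_eq_mk_iff (v w : {v : EuclideanSpace ℝ (Fin (n + 1)) // v ≠ 0}) :
    mk v = mk w ↔ ∃ a : ℝ, a • w.1 = v.1 :=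
  Projectivization.mk_eq_mk_iff' ℝ v.1 w.1 v.2 w.2

theorem exists_smul_rep_mk (v : {v : EuclideanSpace ℝ (Fin (n + 1)) // v ≠ 0}) :
    ∃ a : ℝ, a ≠ 0 ∧ (mk v).rep = a • v.1 := by
  obtain ⟨a, ha⟩ := Projectivization.exists_smul_eq_mk_rep ℝ v.1 v.2
  exact ⟨a, a.ne_zero, ha.symm⟩

theorem isQuotientMap_mk : Topology.IsQuotientMap (mk (n := n)) :=
  ⟨⟨rfl⟩, fun x => ⟨⟨x.rep, x.rep_ne_zero⟩, x.mk_rep⟩⟩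

/-- The affine coordinates `(v₀ / vᵢ, …, vₙ / vᵢ)` (with the `i`-th one omitted). -/
def affineCoord (i : Fin (n + 1)) (v : EuclideanSpace ℝ (Fin (n + 1))) :
    EuclideanSpace ℝ (Fin n) :=
  WithLp.toLp 2 fun j => v (i.succAbove j) / v i

/-- The vector whose `i`-th coordinate is `1` and whose other coordinates are those of `y`. -/
def affineVec (i : Fin (n + 1)) (y : EuclideanSpace ℝ (Fin n)) :
    EuclideanSpace ℝ (Fin (n + 1)) :=
  WithLp.toLp 2 (i.insertNth (α := fun _ => ℝ) 1 y)

@[simp] theorem affineVec_same (i : Fin (n + 1)) (y : EuclideanSpace ℝ (Fin n)) :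
    affineVec i y i = 1 := by simp [affineVec]

@[simp] theorem affineVec_succAbove (i : Fin (n + 1)) (y : EuclideanSpace ℝ (Fin n)) (j : Fin n) :
    affineVec i y (i.succAbove j) = y j := by simp [affineVec]

theorem affineVec_ne_zero (i : Fin (n + 1)) (y : EuclideanSpace ℝ (Fin n)) :
    affineVec i y ≠ 0 := by
  intro h
  have := affineVec_same i y
  simp [h] at this

theorem affineCoord_smul (i : Fin (n + 1)) {a : ℝ} (ha : a ≠ 0)
    (v : EuclideanSpace ℝ (Fin (n + 1))) : affineCoord i (a • v) = affineCoord i v := by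
  ext j
  simp [affineCoord, mul_div_mul_left _ _ ha]

theorem affineCoord_affineVec (i : Fin (n + 1)) (y : EuclideanSpace ℝ (Fin n)) :
    affineCoord i (affineVec i y) = y := by
  ext j
  simp [affineCoord]

theorem smul_affineVec_affineCoord (i : Fin (n + 1)) {v : EuclideanSpace ℝ (Fin (n + 1))}
    (hv : v i ≠ 0) : v i • affineVec i (affineCoord i v) = v := by
  ext k
  rcases Fin.eq_self_or_eq_succAbove i k with rfl | ⟨j, rfl⟩
  · simp
  · simp [affineCoord, mul_div_cancel₀ _ hv]

theorem contDiffOn_affineCoord (i : Fin (n + 1)) :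
    ContDiffOn ℝ ω (affineCoord i) {v | v i ≠ 0} := by
  rw [contDiffOn_euclidean]
  intro j
  have h : ∀ k : Fin (n + 1), ContDiff ℝ ω fun v : EuclideanSpace ℝ (Fin (n + 1)) => v k :=
    fun k => contDiff_euclidean.1 contDiff_id k
  exact (h _).contDiffOn.div (h _).contDiffOn fun v hv => hv

theorem contDiff_affineVec (i : Fin (n + 1)) : ContDiff ℝ ω (affineVec (n := n) i) := by
  rw [contDiff_euclidean]
  intro k
  rcases Fin.eq_self_or_eq_succAbove i k with rfl | ⟨j, rfl⟩
  · simpa using contDiff_const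
  · simpa using contDiff_euclidean.1 contDiff_id j

theorem affineCoord_rep_mk (i : Fin (n + 1)) (v : {v : EuclideanSpace ℝ (Fin (n + 1)) // v ≠ 0}) :
    affineCoord i (mk v).rep = affineCoord i v.1 := by
  obtain ⟨a, ha, h⟩ := exists_smul_rep_mk v
  rw [h, affineCoord_smul i ha]

theorem rep_mk_apply_ne_zero (i : Fin (n + 1))
    (v : {v : EuclideanSpace ℝ (Fin (n + 1)) // v ≠ 0}) : (mk v).rep i ≠ 0 ↔ v.1 i ≠ 0 := by
  obtain ⟨a, ha, h⟩ := exists_smul_rep_mk v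
  simp [h, ha]

theorem isOpen_rep_ne_zero (i : Fin (n + 1)) : IsOpen {x : RealProj n | x.rep i ≠ 0} := by
  rw [← isQuotientMap_mk.isOpen_preimage]
  have : mk ⁻¹' {x : RealProj n | x.rep i ≠ 0} = {v | v.1 i ≠ 0} := by
    ext v
    exact rep_mk_apply_ne_zero i v
  rw [this]
  exact isOpen_ne_fun (by fun_prop) continuous_const

/-- The standard affine chart on the set where the `i`-th homogeneous coordinate is nonzero. -/
def affineChart (i : Fin (n + 1)) :
    OpenPartialHomeomorph (RealProj n) (EuclideanSpace ℝ (Fin n)) where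
  toFun x := affineCoord i x.rep
  invFun y := mk ⟨affineVec i y, affineVec_ne_zero i y⟩
  source := {x | x.rep i ≠ 0}
  target := Set.univ
  map_source' _ _ := Set.mem_univ _
  map_target' y _ := (rep_mk_apply_ne_zero i _).2 (by simp)
  left_inv' x hx := by
    conv_rhs => rw [← mk_rep x]
    rw [mk_eq_mk_iff]
    refine ⟨(x.rep i)⁻¹, ?_⟩
    change (x.rep i)⁻¹ • x.rep = affineVec i (affineCoord i x.rep)
    conv_lhs => rw [← smul_affineVec_affineCoord i hx]
    rw [smul_smul, affineVec, PiLp.smul_apply]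
    simp [inv_mul_cancel₀ hx]
  right_inv' y _ := by rw [affineCoord_rep_mk, affineCoord_affineVec]
  open_source := isOpen_rep_ne_zero i
  open_target := isOpen_univ
  continuousOn_toFun := by
    rw [isQuotientMap_mk.continuousOn_isOpen_iff (isOpen_rep_ne_zero i)]
    have : (fun x : RealProj n => affineCoord i x.rep) ∘ mk = fun v => affineCoord i v.1 := by
      ext1 v
      exact affineCoord_rep_mk i v
    rw [this]
    refine (contDiffOn_affineCoord i).continuousOn.comp continuous_subtype_val.continuousOn ?_
    intro v hv
    exact (rep_mk_apply_ne_zero i v).1 hv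
  continuousOn_invFun :=
    (isQuotientMap_mk.continuous.comp
      ((contDiff_affineVec i).continuous.subtype_mk _)).continuousOn

theorem exists_rep_ne_zero (x : RealProj n) : ∃ i, x.rep i ≠ 0 := by
  by_contra! h
  exact x.rep_ne_zero (by ext i; simpa using h i)

/-- Real projective space with its atlas of the `n + 1` standard affine charts. -/
instance : ChartedSpace (EuclideanSpace ℝ (Fin n)) (RealProj n) where
  atlas := Set.range affineChart
  chartAt x := affineChart x.exists_rep_ne_zero.choose
  mem_chart_source x := x.exists_rep_ne_zero.choose_spec
  chart_mem_atlas _ := ⟨_, rfl⟩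

instance : IsManifold (𝓡 n) ∞ (RealProj n) := by
  apply isManifold_of_contDiffOn
  rintro _ _ ⟨i, rfl⟩ ⟨k, rfl⟩
  have h : ContDiffOn ℝ ∞ (fun y : EuclideanSpace ℝ (Fin n) => affineCoord k (affineVec i y))
      {y | affineVec i y k ≠ 0} :=
    ((contDiffOn_affineCoord k).comp (contDiff_affineVec i).contDiffOn fun y hy => hy).of_le le_top
  refine (h.mono ?_).congr ?_
  · rintro y ⟨hy, -⟩
    simp only [modelWithCornersSelf_coe_symm, Set.preimage_id,
      OpenPartialHomeomorph.trans_source] at hy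
    exact (rep_mk_apply_ne_zero k _).1 hy.2
  · rintro y -
    exact affineCoord_rep_mk k _

end RealProj

/-! ### Tangent spaces of submanifolds, transversality, isotopy -/

/-- The tangent space at `x` of a submanifold `S` of real projective `n`-space: it is spanned by
the velocities at `x` of the smooth curves that lie in `S`. -/
def tangentSpaceOf {n : ℕ} (S : Set (RealProj n)) (x : RealProj n) :
    Submodule ℝ (TangentSpace (𝓡 n) x) :=
  Submodule.span ℝ {v | ∃ γ : ℝ → RealProj n, ContMDiff 𝓘(ℝ, ℝ) (𝓡 n) ∞ γ ∧ (∀ t, γ t ∈ S) ∧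
    ∃ h : γ 0 = x, v = h ▸ mfderiv 𝓘(ℝ, ℝ) (𝓡 n) γ 0 (1 : ℝ)}

/-- Two submanifolds are transverse if their tangent spaces at each common point together span
the tangent space of the ambient projective space. -/
def AreTransverse {n : ℕ} (S T : Set (RealProj n)) : Prop :=
  ∀ x ∈ S ∩ T, tangentSpaceOf S x ⊔ tangentSpaceOf T x = ⊤

/-- Smooth ambient isotopy of subsets of real projective `n`-space: there is a smooth family
`φ t`, `t ∈ [0, 1]`, of diffeomorphisms with `φ 0 = id` and `φ 1` taking `L` to `L'`. -/
def AreIsotopic {n : ℕ} (L L' : Set (RealProj n)) : Prop :=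
  ∃ φ : ℝ → (RealProj n ≃ₘ^∞⟮𝓡 n, 𝓡 n⟯ RealProj n),
    ContMDiffOn (𝓘(ℝ, ℝ).prod (𝓡 n)) (𝓡 n) ∞ (fun y : ℝ × RealProj n => φ y.1 y.2)
      (Set.Icc 0 1 ×ˢ Set.univ) ∧
    (∀ x, φ 0 x = x) ∧ φ 1 '' L = L'

/-! ### The plane section number -/

/-- A projective plane in `ℝP³`: the set of lines contained in a `3`-dimensional linear subspace
of `ℝ⁴`. -/
def IsProjPlane (P : Set (RealProj 3)) : Prop :=
  ∃ W : Submodule ℝ (EuclideanSpace ℝ (Fin 4)), Module.finrank ℝ W = 3 ∧ P = {x | x.rep ∈ W}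

/-- The plane section number of a link `L` in `ℝP³`: the smallest number of points in which a
link isotopic to `L` meets a plane that is generic, that is transverse, to it. -/
def planeSectionNumber (L : Set (RealProj 3)) : ℕ∞ :=
  sInf {m | ∃ L' P : Set (RealProj 3), AreIsotopic L L' ∧ IsProjPlane P ∧ AreTransverse L' P ∧
    m = (L' ∩ P).encard}

/-! ### Projective torus links -/

/-- `z ^ p` for `p ≥ 0`, and the power `|p|` of the complex conjugate of `z` for `p < 0`. -/
def conjPow (z : ℂ) (p : ℤ) : ℂ :=
  if 0 ≤ p then z ^ p.natAbs else (starRingEnd ℂ z) ^ p.natAbs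

/-- The torus link `z ^ p = w ^ q` in the sphere `|z|² + |w|² = 2` of `ℂ² = ℝ⁴`, where
`z = v₀ + i v₁` and `w = v₂ + i v₃`; for a negative exponent the power is replaced by that of the
conjugate. -/
def torusLink (p q : ℤ) : Set (EuclideanSpace ℝ (Fin 4)) :=
  {v | ‖(⟨v 0, v 1⟩ : ℂ)‖ ^ 2 + ‖(⟨v 2, v 3⟩ : ℂ)‖ ^ 2 = 2 ∧
    conjPow ⟨v 0, v 1⟩ p = conjPow ⟨v 2, v 3⟩ q}

/-- The projective torus link: the image in `ℝP³` of the torus link. -/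
def projTorusLink (p q : ℤ) : Set (RealProj 3) :=
  {x | ∃ v : {v : EuclideanSpace ℝ (Fin 4) // v ≠ 0}, v.1 ∈ torusLink p q ∧ RealProj.mk v = x}

end

/-!
A plane section of the torus link itself realises the minimum: the plane `Re z = 0` meets the link
in `|q|` points, the plane `Re w = 0` in `|p|` points, and if one of `p`, `q` is zero then a
rotated plane misses the link (`planeSectionNumber_le_right`, `planeSectionNumber_le_left`,
`planeSectionNumber_zero_right`, `planeSectionNumber_zero_left`).

For the lower bound, the isotopy is lifted to a homogeneous diffeomorphism `H` of `ℝ⁴ ∖ 0`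
(`exists_homogeneous_lift`). A plane with normal vector `u` pulls back to the zeros of the height
function `⟪u, H (e^{ix}, e^{iy})⟫` on the torus, which is odd under the antipodal map
`(x, y) ↦ (x + π, y + π)`. By transversality its zeros on the link are simple
(`IsHomogeneousDiffeo.fderiv_heightFn_ne_zero`). So `u` can be tilted until `0` is a regular value
of the height function (`IsHomogeneousDiffeo.dense_regular`), without new zeros on the link
(`IsHomogeneousDiffeo.eventually_exists_injection`).

The rest is topology of the torus, in terms of periodic subsets of the plane of angles. As the set
where the height is positive and its antipode cover the torus up to the regular zero set, the former
contains a homologically nontrivial loop (`IsOddOnTorus.exists_hasLoop_pos`), of class `(a, b)` say.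
The linking number `a b` of this loop with its antipode is zero, because `H` maps the two loops to
opposite half-spaces (`IsHomogeneousDiffeo.mul_eq_zero_of_hasLoop`). So the loop winds in only one
of the two angles. If that is `x`, then the loop and its antipode, which lie in regions of
different sign, cross every line `p x - q y = 2πk` of the link in alternation, and counting gives
at least `|p|` zeros on the link (`IsOddOnTorus.natAbs_le_card`). If it is `y`, there are at least
`|q|` zeros by symmetry.

Homology theory is replaced by winding numbers: intersection numbers and cup products on the torus
come from `exists_eq_zero_of_norm_sub_le`, and a class in `H¹` that vanishes on a subset of the torus
is used as a branch of an angular function there (`exists_branch`).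
-/

noncomputable section

namespace PlaneSection

/-! ### A winding number argument in the plane -/

open Complex in
theorem exists_continuous_log {A : Type*} [TopologicalSpace A] [SimplyConnectedSpace A]
    [LocallyPathConnectedSpace A] {D : A → ℂ} (hD : Continuous D) (h0 : ∀ z, D z ≠ 0) :
    ∃ L : A → ℂ, Continuous L ∧ ∀ z, exp (L z) = D z := by
  obtain ⟨a⟩ := (inferInstance : Nonempty A)
  obtain ⟨F, ⟨-, hF⟩, -⟩ := isCoveringMapOn_exp.existsUnique_continuousMap_lifts
    (f := ⟨D, hD⟩) (a₀ := a) (e₀ := log (D a)) (by rw [exp_log (h0 a)]; rfl) (by intro z; exact h0 z)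
  exact ⟨F, F.continuous, fun z => congrFun hF z⟩

open Complex in
theorem eq_of_exp_eq {A : Type*} [TopologicalSpace A] [PreconnectedSpace A] {g : A → ℂ}
    (hg : Continuous g) (h : ∀ x y, exp (g x) = exp (g y)) (x y : A) : g x = g y :=
  isCoveringMap_exp.const_of_comp hg (fun x y => Subtype.ext (h x y)) x y

open Complex in
/-- A map of the plane at bounded distance from the identity has a zero: on a large circle it has
winding number `1`, and a nonvanishing map of the plane has winding number `0` on every circle. -/
theorem exists_eq_zero_of_norm_sub_le {K : ℂ → ℂ} (hK : Continuous K) {C : ℝ}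
    (hC : ∀ z, ‖K z - z‖ ≤ C) : ∃ z, K z = 0 := by
  by_contra! h0
  obtain ⟨L, hL, hLK⟩ := exists_continuous_log hK h0
  have hC0 : 0 ≤ C := (norm_nonneg _).trans (hC 0)
  have hR : (0 : ℝ) < C + 1 := by linarith
  have hRC : ((C + 1 : ℝ) : ℂ) ≠ 0 := by exact_mod_cast hR.ne'
  let c : ℝ → ℂ := fun θ => (C + 1 : ℝ) * exp (θ * I)
  have hc0 : ∀ θ, c θ ≠ 0 := fun θ => mul_ne_zero hRC (exp_ne_zero _)
  have hcn : ∀ θ, ‖c θ‖ = C + 1 := fun θ => by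
    simp only [c, norm_mul, norm_exp_ofReal_mul_I, mul_one, norm_real, Real.norm_eq_abs,
      abs_of_pos hR]
  have hcc : Continuous c := by fun_prop
  have hsl : ∀ θ, K (c θ) / c θ ∈ slitPlane := by
    intro θ
    have h1 : ‖K (c θ) / c θ - 1‖ < 1 := by
      rw [div_sub_one (hc0 θ), norm_div, hcn, div_lt_one hR]
      linarith [hC (c θ)]
    have := mem_slitPlane_of_norm_lt_one h1
    simpa using this
  let g : ℝ → ℂ := fun θ => L (c θ) - log (K (c θ) / c θ) - θ * I
  have hg : Continuous g := by
    refine ((hL.comp hcc).sub (continuous_iff_continuousAt.2 fun θ => ?_)).sub (by fun_prop)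
    exact ((hK.comp hcc).continuousAt.div hcc.continuousAt (hc0 θ)).clog (hsl θ)
  have hgexp : ∀ θ, exp (g θ) = (C + 1 : ℝ) := by
    intro θ
    have h1 := hc0 θ
    have h2 := h0 (c θ)
    simp only [g]
    rw [exp_sub, exp_sub, hLK, exp_log (div_ne_zero h2 h1)]
    have : exp (θ * I) ≠ 0 := exp_ne_zero _
    field_simp
    exact mul_comm _ _
  have := eq_of_exp_eq hg (fun x y => by rw [hgexp, hgexp]) 0 (2 * Real.pi)
  have hcp : c (2 * Real.pi) = c 0 := by
    simp only [c]; push_cast; rw [exp_two_pi_mul_I]; simp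
  simp only [g, hcp] at this
  have h3 : ((0 : ℝ) : ℂ) * I = (2 * Real.pi : ℝ) * I := by
    linear_combination -this
  have h4 := mul_right_cancel₀ I_ne_zero h3
  have h5 : (0 : ℝ) = 2 * Real.pi := by exact_mod_cast h4
  linarith [Real.pi_pos]

/-! ### Loops on the torus -/

/-- The vector `2π (a, b)` of the period lattice of the torus `ℝ² / (2πℤ)²`. -/
def latt (a b : ℤ) : ℝ × ℝ := (2 * Real.pi * a, 2 * Real.pi * b)

@[simp] theorem latt_fst (a b : ℤ) : (latt a b).1 = 2 * Real.pi * a := rfl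
@[simp] theorem latt_snd (a b : ℤ) : (latt a b).2 = 2 * Real.pi * b := rfl

theorem latt_add (a b a' b' : ℤ) : latt (a + a') (b + b') = latt a b + latt a' b' := by
  ext <;> simp <;> ring

@[simp] theorem latt_zero : latt 0 0 = 0 := by
  ext <;> simp

/-- A subset of the plane that is the preimage of a subset of the torus. -/
def LattInvariant (U : Set (ℝ × ℝ)) : Prop := ∀ P ∈ U, ∀ i j : ℤ, P + latt i j ∈ U

/-- The subset of the torus with preimage `U` contains a loop of homology class `(a, b)`. -/
def HasLoop (U : Set (ℝ × ℝ)) (a b : ℤ) : Prop := ∃ P, JoinedIn U P (P + latt a b)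

theorem JoinedIn.translate {U : Set (ℝ × ℝ)} (hU : LattInvariant U) {P Q : ℝ × ℝ}
    (h : JoinedIn U P Q) (i j : ℤ) : JoinedIn U (P + latt i j) (Q + latt i j) := by
  obtain ⟨γ, hγ⟩ := h
  exact ⟨γ.map (f := fun x => x + latt i j) (by fun_prop), fun t => hU _ (hγ t) i j⟩

/-- A loop on the torus unrolls to a curve in the plane that is periodic up to a translation. -/
theorem exists_wave {U : Set (ℝ × ℝ)} (hU : LattInvariant U) {P : ℝ × ℝ} {a b : ℤ}
    (h : JoinedIn U P (P + latt a b)) :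
    ∃ c : ℝ → ℝ × ℝ, Continuous c ∧ (∀ s, c s ∈ U) ∧ (∀ s, c (s + 1) = c s + latt a b) ∧
      ∃ C, ∀ s, ‖c s - s • latt a b‖ ≤ C := by
  obtain ⟨γ, hγ⟩ := h
  let b₀ : ℝ → ℝ × ℝ := fun s => γ.extend s - s • latt a b
  have hb₀ : Continuous b₀ := by fun_prop
  let f : AddCircle (1 : ℝ) → ℝ × ℝ := AddCircle.liftIco 1 0 b₀
  have hf : Continuous f := by
    apply AddCircle.liftIco_continuous
    · simp [b₀]
    · exact hb₀.continuousOn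
  have : Fact ((0 : ℝ) < 1) := ⟨one_pos⟩
  have hff : ∀ s : ℝ, f s = b₀ (Int.fract s) := by
    intro s
    have h1 : ((Int.fract s : ℝ) : AddCircle (1 : ℝ)) = s := by
      rw [Int.fract, AddCircle.coe_sub]
      have : ((⌊s⌋ : ℝ) : AddCircle (1 : ℝ)) = 0 := by
        rw [AddCircle.coe_eq_zero_iff]; exact ⟨⌊s⌋, by simp⟩
      rw [this, sub_zero]
    rw [← h1]
    exact AddCircle.liftIco_coe_apply ⟨Int.fract_nonneg s, by simpa using Int.fract_lt_one s⟩
  refine ⟨fun s => f s + s • latt a b, ?_, ?_, ?_, ?_⟩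
  · exact (hf.comp (AddCircle.continuous_mk' 1)).add (by fun_prop)
  · intro s
    have h2 : f s + s • latt a b = γ.extend (Int.fract s) + latt (⌊s⌋ * a) (⌊s⌋ * b) := by
      have h3 : s = Int.fract s + ⌊s⌋ := (Int.fract_add_floor s).symm
      rw [hff]
      ext
      · simp only [b₀, Prod.fst_add, Prod.fst_sub, Prod.smul_fst, latt_fst, smul_eq_mul]
        push_cast
        linear_combination (2 * Real.pi * a) * h3
      · simp only [b₀, Prod.snd_add, Prod.snd_sub, Prod.smul_snd, latt_snd, smul_eq_mul]
        push_cast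
        linear_combination (2 * Real.pi * b) * h3
    beta_reduce
    rw [h2]
    apply hU
    rw [γ.extend_apply ⟨Int.fract_nonneg s, (Int.fract_lt_one s).le⟩]
    exact hγ _
  · intro s
    have : ((s + 1 : ℝ) : AddCircle (1 : ℝ)) = s := by
      rw [AddCircle.coe_add, AddCircle.coe_period, add_zero]
    beta_reduce
    rw [this, add_smul, one_smul, add_assoc]
  · obtain ⟨C, hC⟩ := isCompact_univ.exists_bound_of_continuousOn hf.continuousOn
    exact ⟨C, fun s => by simpa using hC s (Set.mem_univ _)⟩

/-- Disjoint loops on the torus have intersection number zero: their lifts to the plane stay near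
two lines, and would meet if these lines were not parallel. -/
theorem HasLoop.mul_eq_mul {U V : Set (ℝ × ℝ)} (hU : LattInvariant U) (hV : LattInvariant V)
    (hUV : Disjoint U V) {a b a' b' : ℤ} (h : HasLoop U a b) (h' : HasLoop V a' b') :
    a * b' = b * a' := by
  by_contra hne
  obtain ⟨P, hP⟩ := h
  obtain ⟨P', hP'⟩ := h'
  obtain ⟨c, hc, hcU, -, C, hC⟩ := exists_wave hU hP
  obtain ⟨c', hc', hcV, -, C', hC'⟩ := exists_wave hV hP'
  have hpi := Real.pi_pos
  let Δ : ℝ := 2 * Real.pi * (b * a' - a * b')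
  have hΔ : Δ ≠ 0 := by
    refine mul_ne_zero (by positivity) fun h => hne ?_
    have : (a * b' : ℝ) = b * a' := by linarith
    exact_mod_cast this
  -- `s` and `t` solve `s • latt a b - t • latt a' b' = ζ`, so `K` is near the identity
  let s : ℂ → ℝ := fun ζ => (a' * ζ.im - b' * ζ.re) / Δ
  let t : ℂ → ℝ := fun ζ => (a * ζ.im - b * ζ.re) / Δ
  let K : ℂ → ℂ := fun ζ => Complex.equivRealProdCLM.symm (c (s ζ) - c' (t ζ))
  have hK : Continuous K := by fun_prop
  have hKb : ∀ ζ, ‖K ζ - ζ‖ ≤ 2 * (C + C') := by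
    intro ζ
    have h1 := hC (s ζ)
    have h2 := hC' (t ζ)
    set v := c (s ζ) - s ζ • latt a b with hv
    set w := c' (t ζ) - t ζ • latt a' b' with hw
    have h3 : K ζ - ζ = Complex.equivRealProdCLM.symm (v - w) := by
      have e1 : s ζ * (2 * Real.pi * a) - t ζ * (2 * Real.pi * a') = ζ.re := by
        simp only [s, t]; field_simp; simp only [Δ]; ring
      have e2 : s ζ * (2 * Real.pi * b) - t ζ * (2 * Real.pi * b') = ζ.im := by
        simp only [s, t]; field_simp; simp only [Δ]; ring
      apply Complex.ext
      · simp [K, hv, hw]; linarith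
      · simp [K, hv, hw]; linarith
    rw [h3]
    have h4 : ‖v - w‖ ≤ C + C' := (norm_sub_le _ _).trans (add_le_add h1 h2)
    refine (Complex.norm_le_abs_re_add_abs_im _).trans ?_
    have h5 : |(v - w).1| ≤ ‖v - w‖ := norm_fst_le (v - w)
    have h6 : |(v - w).2| ≤ ‖v - w‖ := norm_snd_le (v - w)
    have h7 : (Complex.equivRealProdCLM.symm (v - w)).re = (v - w).1 := rfl
    have h8 : (Complex.equivRealProdCLM.symm (v - w)).im = (v - w).2 := rfl
    rw [h7, h8]
    linarith
  obtain ⟨ζ, hζ⟩ := exists_eq_zero_of_norm_sub_le hK hKb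
  have h9 : c (s ζ) - c' (t ζ) = 0 := by
    simpa only [K, map_eq_zero_iff _ Complex.equivRealProdCLM.symm.injective] using hζ
  exact Set.disjoint_left.1 hUV (hcU (s ζ)) (sub_eq_zero.1 h9 ▸ hcV (t ζ))

/-- If the integral character `(a, b) ↦ α a + β b` vanishes on the loops in `U`, then it is
realised by an integer labelling of the path components of `U`. -/
theorem exists_label {U : Set (ℝ × ℝ)} (hU : LattInvariant U) (α β : ℤ)
    (hχ : ∀ a b, HasLoop U a b → α * a + β * b = 0) :
    ∃ N : ℝ × ℝ → ℤ, (∀ P Q, JoinedIn U P Q → N P = N Q) ∧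
      ∀ P ∈ U, ∀ i j, N (P + latt i j) = N P + (α * i + β * j) := by
  classical
  let S : Setoid U :=
    { r := fun P Q => ∃ i j, JoinedIn U P (Q + latt i j)
      iseqv :=
        { refl := fun P => ⟨0, 0, by simpa using JoinedIn.refl P.2⟩
          symm := by
            rintro P Q ⟨i, j, h⟩
            refine ⟨-i, -j, ?_⟩
            have := JoinedIn.translate hU h.symm (-i) (-j)
            rwa [add_assoc, ← latt_add, add_neg_cancel, add_neg_cancel, latt_zero, add_zero] at this
          trans := by
            rintro P Q R ⟨i, j, h⟩ ⟨i', j', h'⟩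
            refine ⟨i' + i, j' + j, h.trans ?_⟩
            have := JoinedIn.translate hU h' i j
            rwa [add_assoc, ← latt_add] at this } }
  let r : U → U := fun P => (Quotient.mk S P).out
  have hr : ∀ P : U, ∃ i j, JoinedIn U P (r P + latt i j) := fun P =>
    S.symm (Quotient.exact (Quotient.out_eq (Quotient.mk S P)))
  have hr2 : ∀ P Q : U, (∃ i j, JoinedIn U P (Q + latt i j)) → r P = r Q := fun P Q h => by
    have : Quotient.mk S P = Quotient.mk S Q := Quotient.sound h
    simp only [r, this]
  choose I J hIJ using hr
  have huniq : ∀ P : U, ∀ i j, JoinedIn U P (r P + latt i j) →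
      α * I P + β * J P = α * i + β * j := by
    intro P i j h
    have h1 := JoinedIn.translate hU (h.symm.trans (hIJ P)) (-i) (-j)
    rw [add_assoc, add_assoc, ← latt_add, ← latt_add, add_neg_cancel, add_neg_cancel, latt_zero,
      add_zero] at h1
    have := hχ _ _ ⟨_, h1⟩
    linear_combination this
  refine ⟨fun P => if h : P ∈ U then α * I ⟨P, h⟩ + β * J ⟨P, h⟩ else 0, ?_, ?_⟩
  · intro P Q h
    have hP := h.source_mem
    have hQ := h.target_mem
    simp only [hP, hQ, dif_pos]
    have e : r ⟨P, hP⟩ = r ⟨Q, hQ⟩ := hr2 _ _ ⟨0, 0, by simpa using h⟩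
    apply huniq
    rw [e]
    exact h.trans (hIJ ⟨Q, hQ⟩)
  · intro P hP i j
    have hQ := hU P hP i j
    simp only [hP, hQ, dif_pos]
    have e : r ⟨P + latt i j, hQ⟩ = r ⟨P, hP⟩ := hr2 _ _ ⟨i, j, JoinedIn.refl hQ⟩
    rw [huniq ⟨P + latt i j, hQ⟩ (I ⟨P, hP⟩ + i) (J ⟨P, hP⟩ + j)]
    · ring
    · rw [e, latt_add, ← add_assoc]
      exact JoinedIn.translate hU (hIJ ⟨P, hP⟩) i j

/-- If the character `(a, b) ↦ α a + β b` vanishes on the loops in `U`, then the multivalued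
function `α x + β y` on the torus has a continuous single-valued branch on `U`. -/
theorem exists_branch {U : Set (ℝ × ℝ)} (hU : LattInvariant U) (hUo : IsOpen U) (α β : ℤ)
    (hχ : ∀ a b, HasLoop U a b → α * a + β * b = 0) :
    ∃ θ : ℝ × ℝ → ℝ, ContinuousOn θ U ∧ (∀ P ∈ U, ∀ i j, θ (P + latt i j) = θ P) ∧
      ∀ P, ∃ n : ℤ, θ P = α * P.1 + β * P.2 + 2 * Real.pi * n := by
  obtain ⟨N, hN1, hN2⟩ := exists_label hU α β hχ
  refine ⟨fun P => α * P.1 + β * P.2 - 2 * Real.pi * N P, ?_, ?_, ?_⟩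
  · intro P hP
    apply ContinuousAt.continuousWithinAt
    have h1 : ContinuousAt (fun Q : ℝ × ℝ => α * Q.1 + β * Q.2 - 2 * Real.pi * N P) P := by
      fun_prop
    refine h1.congr ?_
    obtain ⟨ε, hε, hball⟩ := Metric.isOpen_iff.1 hUo P hP
    filter_upwards [Metric.ball_mem_nhds P hε] with Q hQ
    have : JoinedIn U P Q :=
      (((convex_ball P ε).isPathConnected ⟨P, Metric.mem_ball_self hε⟩).joinedIn P
        (Metric.mem_ball_self hε) Q hQ).mono hball
    rw [hN1 P Q this]
  · intro P hP i j
    simp only [hN2 P hP]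
    push_cast
    simp
    ring
  · intro P
    exact ⟨-N P, by push_cast; ring⟩

/-! ### Odd functions on the torus -/

/-- The vector `(π, π)`; translating by it induces the antipodal map of the torus. -/
def halfPeriod : ℝ × ℝ := (Real.pi, Real.pi)

/-- A continuous function on the torus `|z| = |w|`, as a function of the two angles, that is odd
with respect to the antipodal map. -/
structure IsOddOnTorus (G : ℝ × ℝ → ℝ) : Prop where
  continuous : Continuous G
  add_latt : ∀ P i j, G (P + latt i j) = G P
  add_halfPeriod : ∀ P, G (P + halfPeriod) = -G P

/-- The points of the torus link `z ^ p = w ^ q`, in terms of the angles of `z` and `w`. -/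
def OnLink (p q : ℤ) (P : ℝ × ℝ) : Prop := ∃ k : ℤ, p * P.1 - q * P.2 = 2 * Real.pi * k

namespace IsOddOnTorus

variable {G : ℝ × ℝ → ℝ} (hG : IsOddOnTorus G)
include hG

theorem lattInvariant (s : Set ℝ) : LattInvariant (G ⁻¹' s) := fun P hP i j => by
  rwa [Set.mem_preimage, hG.add_latt]

theorem sub_halfPeriod (P : ℝ × ℝ) : G (P - halfPeriod) = -G P := by
  have := hG.add_halfPeriod (P - halfPeriod)
  rw [sub_add_cancel] at this
  linarith

theorem joinedIn_add_halfPeriod {s t : Set ℝ} (hst : ∀ x ∈ s, -x ∈ t) {P Q : ℝ × ℝ}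
    (h : JoinedIn (G ⁻¹' s) P Q) :
    JoinedIn (G ⁻¹' t) (P + halfPeriod) (Q + halfPeriod) := by
  obtain ⟨γ, hγ⟩ := h
  refine ⟨γ.map (f := fun x => x + halfPeriod) (by fun_prop), fun τ => ?_⟩
  change G (γ τ + halfPeriod) ∈ t
  rw [hG.add_halfPeriod]
  exact hst _ (hγ τ)

theorem joinedIn_sub_halfPeriod {s t : Set ℝ} (hst : ∀ x ∈ s, -x ∈ t) {P Q : ℝ × ℝ}
    (h : JoinedIn (G ⁻¹' s) P Q) :
    JoinedIn (G ⁻¹' t) (P - halfPeriod) (Q - halfPeriod) := by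
  obtain ⟨γ, hγ⟩ := h
  refine ⟨γ.map (f := fun x => x - halfPeriod) (by fun_prop), fun τ => ?_⟩
  change G (γ τ - halfPeriod) ∈ t
  rw [hG.sub_halfPeriod]
  exact hst _ (hγ τ)

theorem hasLoop_neg {s t : Set ℝ} (hst : ∀ x ∈ s, -x ∈ t) {a b : ℤ}
    (h : HasLoop (G ⁻¹' s) a b) : HasLoop (G ⁻¹' t) a b := by
  obtain ⟨P, hP⟩ := h
  refine ⟨P + halfPeriod, ?_⟩
  have := hG.joinedIn_add_halfPeriod hst hP
  rwa [add_right_comm] at this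

/-- All loops on which `G` is positive are homologically parallel. -/
theorem hasLoop_parallel {a b a' b' : ℤ} (h : HasLoop (G ⁻¹' Set.Ioi 0) a b)
    (h' : HasLoop (G ⁻¹' Set.Ioi 0) a' b') : a * b' = b * a' := by
  have h2 : HasLoop (G ⁻¹' Set.Iio 0) a' b' := hG.hasLoop_neg (fun x hx => by simpa using hx) h'
  refine HasLoop.mul_eq_mul (hG.lattInvariant _) (hG.lattInvariant _) ?_ h h2
  exact Disjoint.preimage _ (Set.disjoint_left.2 fun x hx hx' => lt_asymm (show 0 < x from hx) hx')

end IsOddOnTorus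

theorem exists_add_latt_mem_Icc (P : ℝ × ℝ) :
    ∃ i j, P + latt i j ∈ Set.Icc (0 : ℝ × ℝ) (2 * Real.pi, 2 * Real.pi) := by
  have hpi : 0 < 2 * Real.pi := by positivity
  have key : ∀ x : ℝ, ∃ i : ℤ, x + 2 * Real.pi * i ∈ Set.Icc 0 (2 * Real.pi) := fun x => by
    obtain ⟨i, hi, -⟩ := existsUnique_add_zsmul_mem_Ico hpi x 0
    refine ⟨i, ?_⟩
    rw [zsmul_eq_mul, zero_add] at hi
    exact ⟨by linarith [hi.1], by linarith [hi.2]⟩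
  obtain ⟨i, hi⟩ := key P.1
  obtain ⟨j, hj⟩ := key P.2
  exact ⟨i, j, ⟨hi.1, hj.1⟩, ⟨hi.2, hj.2⟩⟩

/-- A periodic function on a periodic closed set extends to a bounded function of the plane. -/
theorem exists_bounded_extension {F : Set (ℝ × ℝ)} (hF : LattInvariant F) (hFc : IsClosed F)
    {α : ℝ × ℝ → ℝ} (hα : ContinuousOn α F) (hper : ∀ P ∈ F, ∀ i j, α (P + latt i j) = α P) :
    ∃ (α' : ℝ × ℝ → ℝ) (C : ℝ), Continuous α' ∧ (∀ P ∈ F, α' P = α P) ∧ ∀ P, |α' P| ≤ C := by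
  have hcomp : IsCompact (F ∩ Set.Icc (0 : ℝ × ℝ) (2 * Real.pi, 2 * Real.pi)) :=
    isCompact_Icc.inter_left hFc
  obtain ⟨C, hC⟩ := hcomp.exists_bound_of_continuousOn (hα.mono Set.inter_subset_left)
  have hC' : ∀ P ∈ F, |α P| ≤ max C 0 := by
    intro P hP
    obtain ⟨i, j, hij⟩ := exists_add_latt_mem_Icc P
    rw [← hper P hP i j]
    exact (hC _ ⟨hF P hP i j, hij⟩).trans (le_max_left _ _)
  obtain ⟨g, hg1, hg2⟩ := ContinuousMap.exists_restrict_eq_forall_mem_of_closed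
    (f := ⟨F.domRestrict α, hα.domRestrict⟩) (t := Set.Icc (-(max C 0)) (max C 0))
    (fun P => abs_le.1 (hC' P P.2)) ⟨0, by simp⟩ hFc
  refine ⟨g, max C 0, g.continuous, fun P hP => ?_, fun P => abs_le.2 (hg1 P)⟩
  exact congrArg (fun f : C(F, ℝ) => f ⟨P, hP⟩) hg2

/-- The neighbourhoods of the sets `G ≥ 0` and `G ≤ 0` are antipodal and cover the torus. They
carry nontrivial loops, for otherwise the class of the first angle would vanish on one set and that
of the second angle on the other, and the cup product of these two classes would be zero. -/
theorem IsOddOnTorus.exists_hasLoop {G : ℝ × ℝ → ℝ} (hG : IsOddOnTorus G) {δ : ℝ} (hδ : 0 < δ) :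
    ∃ a b, ¬(a = 0 ∧ b = 0) ∧ HasLoop (G ⁻¹' Set.Ioi (-δ)) a b := by
  by_contra! hno
  have hno' : ∀ a b, HasLoop (G ⁻¹' Set.Iio δ) a b → a = 0 ∧ b = 0 := fun a b h => by
    by_contra hab
    exact hno a b (not_and.1 hab) (hG.hasLoop_neg (fun x (hx : x < δ) => neg_lt_neg hx) h)
  have hno'' : ∀ a b, HasLoop (G ⁻¹' Set.Ioi (-δ)) a b → a = 0 ∧ b = 0 := fun a b h => by
    by_contra hab
    exact hno a b (not_and.1 hab) h
  obtain ⟨α, hα, hαp, hαx⟩ := exists_branch (hG.lattInvariant (Set.Ioi (-δ)))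
    (isOpen_Ioi.preimage hG.continuous) 1 0 (fun a b h => by simp [(hno'' a b h).1])
  obtain ⟨β, hβ, hβp, hβx⟩ := exists_branch (hG.lattInvariant (Set.Iio δ))
    (isOpen_Iio.preimage hG.continuous) 0 1 (fun a b h => by simp [(hno' a b h).2])
  have s1 : G ⁻¹' Set.Ici 0 ⊆ G ⁻¹' Set.Ioi (-δ) :=
    Set.preimage_mono fun x (hx : 0 ≤ x) => show -δ < x by linarith
  have s2 : G ⁻¹' Set.Iic 0 ⊆ G ⁻¹' Set.Iio δ :=
    Set.preimage_mono fun x (hx : x ≤ 0) => show x < δ by linarith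
  obtain ⟨α', C, hα'c, hα', hC⟩ := exists_bounded_extension (hG.lattInvariant (Set.Ici 0))
    (isClosed_Ici.preimage hG.continuous) (hα.mono s1) (fun P hP => hαp P (s1 hP))
  obtain ⟨β', C', hβ'c, hβ', hC'⟩ := exists_bounded_extension (hG.lattInvariant (Set.Iic 0))
    (isClosed_Iic.preimage hG.continuous) (hβ.mono s2) (fun P hP => hβp P (s2 hP))
  have hpi := Real.pi_pos
  -- at a zero of `K`, one of the branches differs from its angle by `π`
  let K : ℂ → ℂ := fun ζ => ζ - ((α' (ζ.re, ζ.im) + Real.pi : ℝ) +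
    (β' (ζ.re, ζ.im) + Real.pi : ℝ) * Complex.I)
  have hK : Continuous K := by fun_prop
  obtain ⟨ζ, hζ⟩ := exists_eq_zero_of_norm_sub_le hK (C := C + Real.pi + (C' + Real.pi))
    (fun ζ => by
      have h1 : |α' (ζ.re, ζ.im) + Real.pi| ≤ C + Real.pi :=
        (abs_add_le _ _).trans (add_le_add (hC _) (abs_of_pos hpi).le)
      have h2 : |β' (ζ.re, ζ.im) + Real.pi| ≤ C' + Real.pi :=
        (abs_add_le _ _).trans (add_le_add (hC' _) (abs_of_pos hpi).le)
      simp only [K, sub_sub_cancel_left, norm_neg]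
      refine (Complex.norm_le_abs_re_add_abs_im _).trans ?_
      simpa using add_le_add h1 h2)
  have hre : ζ.re = α' (ζ.re, ζ.im) + Real.pi := by
    have := congrArg Complex.re hζ
    simp [K] at this
    linarith
  have him : ζ.im = β' (ζ.re, ζ.im) + Real.pi := by
    have := congrArg Complex.im hζ
    simp [K] at this
    linarith
  have key : ∀ n : ℤ, Real.pi ≠ -(2 * Real.pi * n) := fun n h => by
    have : (1 : ℝ) = -(2 * n) := by
      apply mul_left_cancel₀ hpi.ne'; linarith
    have : (1 : ℤ) = -(2 * n) := by exact_mod_cast this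
    omega
  rcases le_total 0 (G (ζ.re, ζ.im)) with h | h
  · rw [hα' _ h] at hre
    obtain ⟨n, hn⟩ := hαx (ζ.re, ζ.im)
    refine key n ?_
    simp at hn
    linarith
  · rw [hβ' _ h] at him
    obtain ⟨n, hn⟩ := hβx (ζ.re, ζ.im)
    refine key n ?_
    simp at hn
    linarith

/-- If `G > 0` carries a loop winding only in the first angle, then `G` has at least `|p|` zeros on
the torus link, up to the antipodal map. The translates of the lifted loop by the multiples of
`(π, π)` lie in different regions of `G ≠ 0`, and each line `p x - q y = 2πk` crosses all of them.
So the `|p|` inequivalent lines have together at least `|p| M` zeros at heights up to about `π M`,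
and each class of zeros has at most one of them in every interval of heights of length `π`. -/
theorem IsOddOnTorus.natAbs_le_card {G : ℝ × ℝ → ℝ} (hG : IsOddOnTorus G) {a : ℤ} (ha : a ≠ 0)
    (h : HasLoop (G ⁻¹' Set.Ioi 0) a 0) {p : ℤ} (hp : p ≠ 0) (q : ℤ) {B : Type*} (S : Finset B)
    (W : ℝ × ℝ → B) (hW : ∀ P, OnLink p q P → G P = 0 → W P ∈ S)
    (hWi : ∀ P P', OnLink p q P → OnLink p q P' → G P = 0 → G P' = 0 → W P = W P' →
      ∃ i j : ℤ, 2 ∣ i - j ∧ P' = P + (Real.pi * i, Real.pi * j)) :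
    p.natAbs ≤ S.card := by
  have hpi := Real.pi_pos
  have hpR : (p : ℝ) ≠ 0 := by exact_mod_cast hp
  have haR : (a : ℝ) ≠ 0 := by exact_mod_cast ha
  -- the labelling of the regions `G > 0` and `G < 0`
  obtain ⟨N, hN1, hN2⟩ := exists_label (hG.lattInvariant (Set.Ioi 0)) 0 1 (fun a' b' h' => by
    have := hG.hasLoop_parallel h h'
    simpa [ha] using this)
  let lab : ℝ × ℝ → ℤ := fun P => if 0 < G P then 2 * N P else 2 * N (P - halfPeriod) + 1
  have hlab : ∀ P Q : ℝ × ℝ, (∀ X ∈ segment ℝ P Q, G X ≠ 0) → lab P = lab Q := by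
    intro P Q hPQ
    have hpc : IsPathConnected (segment ℝ P Q) :=
      (convex_segment P Q).isPathConnected ⟨P, left_mem_segment ℝ P Q⟩
    have hjoin : JoinedIn (segment ℝ P Q) P Q :=
      hpc.joinedIn P (left_mem_segment ℝ P Q) Q (right_mem_segment ℝ P Q)
    have hconst : ∀ X ∈ segment ℝ P Q, ∀ Y ∈ segment ℝ P Q, 0 < G X → 0 < G Y := by
      intro X hX Y hY h1
      by_contra h2
      obtain ⟨Z, hZ, hZ0⟩ := hpc.isConnected.isPreconnected.intermediate_value hY hX
        hG.continuous.continuousOn ⟨not_lt.1 h2, h1.le⟩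
      exact hPQ Z hZ hZ0
    by_cases hP : 0 < G P
    · have hQ := hconst P (left_mem_segment ℝ P Q) Q (right_mem_segment ℝ P Q) hP
      simp only [lab, hP, hQ, if_true]
      rw [hN1 P Q (hjoin.mono fun X hX => hconst P (left_mem_segment ℝ P Q) X hX hP)]
    · have hQ : ¬ 0 < G Q := fun h' => hP
        (hconst Q (right_mem_segment ℝ P Q) P (left_mem_segment ℝ P Q) h')
      simp only [lab, hP, hQ, if_false]
      have hj : JoinedIn (G ⁻¹' Set.Iio 0) P Q := hjoin.mono fun X hX =>
        lt_of_le_of_ne (not_lt.1 fun h' => hP (hconst X hX P (left_mem_segment ℝ P Q) h'))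
          (hPQ X hX)
      rw [hN1 _ _ (hG.joinedIn_sub_halfPeriod (fun x hx => by simpa using hx) hj)]
  -- the translates of the loop
  obtain ⟨P₀, hP₀⟩ := h
  obtain ⟨c, hc, hcU, -, C, hC⟩ := exists_wave (hG.lattInvariant (Set.Ioi 0)) hP₀
  have hC1 : ∀ s, |(c s).1 - s * (2 * Real.pi * a)| ≤ C := fun s => by
    have := (norm_fst_le (c s - s • latt a 0)).trans (hC s)
    simpa using this
  have hC2 : ∀ s, |(c s).2| ≤ C := fun s => by
    have := (norm_snd_le (c s - s • latt a 0)).trans (hC s)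
    simpa using this
  have hC0 : 0 ≤ C := (abs_nonneg _).trans (hC2 0)
  have hNc : ∀ s, N (c s) = N (c 0) := fun s => by
    refine hN1 _ _ ?_
    have hr : IsPathConnected (Set.range c) := isPathConnected_range hc
    exact (hr.joinedIn _ ⟨s, rfl⟩ _ ⟨0, rfl⟩).mono (by rintro _ ⟨t, rfl⟩; exact hcU t)
  have hlabc : ∀ (m : ℤ) (s : ℝ), G (c s + (m : ℝ) • halfPeriod) ≠ 0 ∧
      lab (c s + (m : ℝ) • halfPeriod) = 2 * N (c 0) + m := by
    intro m s
    have hpos : 0 < G (c s) := hcU s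
    obtain ⟨j, rfl⟩ | ⟨j, rfl⟩ := Int.even_or_odd m
    · have e : c s + ((j + j : ℤ) : ℝ) • halfPeriod = c s + latt j j := by
        ext <;> simp [halfPeriod] <;> ring
      rw [e]
      have h1 : 0 < G (c s + latt j j) := by rwa [hG.add_latt]
      refine ⟨h1.ne', ?_⟩
      simp only [lab, h1, if_true]
      rw [hN2 _ (hcU s), hNc]
      ring
    · have e : c s + ((2 * j + 1 : ℤ) : ℝ) • halfPeriod = c s + latt j j + halfPeriod := by
        ext <;> simp [halfPeriod] <;> ring
      rw [e]
      have h1 : G (c s + latt j j + halfPeriod) < 0 := by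
        rw [hG.add_halfPeriod, hG.add_latt]; linarith
      refine ⟨h1.ne, ?_⟩
      simp only [lab, not_lt.2 h1.le, if_false]
      rw [add_sub_cancel_right, hN2 _ (hcU s), hNc]
      ring
  -- points with prescribed label on the lines
  let line : ℤ → ℝ → ℝ × ℝ := fun k y => ((2 * Real.pi * k + q * y) / p, y)
  have hline : ∀ k, Continuous (line k) := fun k => by fun_prop
  have honlink : ∀ k y, p * (line k y).1 - q * (line k y).2 = 2 * Real.pi * k := fun k y => by
    simp only [line]; field_simp; ring
  have hmeet : ∀ k m : ℤ, ∃ y, |y - Real.pi * m| ≤ C ∧ G (line k y) ≠ 0 ∧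
      lab (line k y) = 2 * N (c 0) + m := by
    intro k m
    let f : ℝ → ℝ := fun s => p * ((c s).1 + m * Real.pi) - q * ((c s).2 + m * Real.pi)
    have hf : Continuous f := by fun_prop
    let E : ℝ := |(p : ℝ)| * C + |(q : ℝ)| * C + |(p - q : ℝ) * (m * Real.pi)|
    have hfE : ∀ s, |f s - s * (2 * Real.pi * a * p)| ≤ E := fun s => by
      have e : f s - s * (2 * Real.pi * a * p) = p * ((c s).1 - s * (2 * Real.pi * a)) +
          -(q * (c s).2) + (p - q : ℝ) * (m * Real.pi) := by simp only [f]; ring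
      rw [e]
      refine (abs_add_three _ _ _).trans ?_
      rw [abs_neg, abs_mul, abs_mul (q : ℝ)]
      exact add_le_add (add_le_add (mul_le_mul_of_nonneg_left (hC1 s) (abs_nonneg _))
        (mul_le_mul_of_nonneg_left (hC2 s) (abs_nonneg _))) le_rfl
    have hκ : 2 * Real.pi * a * p ≠ 0 := by positivity
    obtain ⟨s, hs⟩ := mem_range_of_exists_le_of_exists_ge (c := 2 * Real.pi * k) hf
      ⟨(2 * Real.pi * k - E) / (2 * Real.pi * a * p), by
        have := (abs_le.1 (hfE ((2 * Real.pi * k - E) / (2 * Real.pi * a * p)))).2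
        rw [div_mul_cancel₀ _ hκ] at this
        linarith⟩
      ⟨(2 * Real.pi * k + E) / (2 * Real.pi * a * p), by
        have := (abs_le.1 (hfE ((2 * Real.pi * k + E) / (2 * Real.pi * a * p)))).1
        rw [div_mul_cancel₀ _ hκ] at this
        linarith⟩
    have e : line k ((c s).2 + m * Real.pi) = c s + (m : ℝ) • halfPeriod := by
      ext
      · simp only [line, f, halfPeriod] at hs ⊢
        rw [← hs]
        simp
        field_simp
      · simp [line, halfPeriod]
    refine ⟨(c s).2 + m * Real.pi, ?_, ?_⟩
    · convert! hC2 s using 2; ring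
    · rw [e]; exact hlabc m s
  choose Y hYb hY0 hYl using hmeet
  have hsep : ∀ k y₁ y₂, lab (line k y₁) ≠ lab (line k y₂) → y₁ ≤ y₂ →
      ∃ y ∈ Set.Icc y₁ y₂, G (line k y) = 0 := by
    intro k y₁ y₂ hne hle
    by_contra! hno
    refine hne (hlab _ _ ?_)
    intro X hX
    obtain ⟨t, ht, rfl⟩ := (segment_eq_image ℝ (line k y₁) (line k y₂) ▸ hX :)
    have e : (1 - t) • line k y₁ + t • line k y₂ = line k ((1 - t) * y₁ + t * y₂) := by
      ext
      · simp [line]; field_simp; ring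
      · simp [line]
    beta_reduce
    rw [e]
    apply hno
    constructor <;> nlinarith [ht.1, ht.2]
  -- the first zero above each of these points
  obtain ⟨r, hr⟩ := exists_nat_gt (2 * C / Real.pi)
  have hr' : 2 * C < r * Real.pi := by rwa [div_lt_iff₀ hpi] at hr
  have hr0 : (0 : ℤ) < r := by
    have : 0 < (r : ℝ) := by
      by_contra h0
      nlinarith [not_lt.1 h0]
    exact_mod_cast this
  have hfirst : ∀ k m : ℤ, ∃ z, IsLeast {y | y ∈ Set.Icc (Y k m) (Y k (m + r)) ∧
      G (line k y) = 0} z := by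
    intro k m
    apply IsCompact.exists_isLeast
    · have : IsClosed {y | G (line k y) = 0} :=
        isClosed_eq (hG.continuous.comp (hline k)) continuous_const
      exact isCompact_Icc.inter_right this
    · refine (hsep k (Y k m) (Y k (m + r)) ?_ ?_)
      · rw [hYl, hYl]; omega
      · have h1 := (abs_le.1 (hYb k m)).2
        have h2 := (abs_le.1 (hYb k (m + r))).1
        push_cast at h2
        nlinarith
  choose z hz using hfirst
  have hzinj : ∀ k m m', Y k m < Y k m' → z k m = z k m' → m = m' := by
    intro k m m' hlt heq
    by_contra hne
    obtain ⟨y, hy, hy0⟩ := hsep k (Y k m) (Y k m') (by rw [hYl, hYl]; omega) hlt.le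
    have h1 : Y k m' ≤ z k m := heq ▸ (hz k m').1.1.1
    have h2 : z k m ≤ y := (hz k m).2 ⟨⟨hy.1, (hy.2.trans h1).trans (hz k m).1.1.2⟩, hy0⟩
    have h3 : y = Y k m' := le_antisymm hy.2 (h1.trans h2)
    exact hY0 k m' (h3 ▸ hy0)
  have hzinj' : ∀ k m m', z k m = z k m' → m = m' := by
    intro k m m' heq
    rcases lt_trichotomy (Y k m) (Y k m') with hlt | heq' | hlt
    · exact hzinj k m m' hlt heq
    · have := hYl k m
      rw [heq', hYl] at this
      omega
    · exact (hzinj k m' m hlt heq.symm).symm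
  -- the class of a zero and the integral part of its height over `π` determine the zero
  obtain ⟨D, hD⟩ := exists_nat_gt (2 * C / Real.pi + r)
  have hcount : ∀ M : ℕ, p.natAbs * M ≤ S.card * (M + D) := by
    intro M
    let Z : ℕ × ℕ → ℝ × ℝ := fun km => line km.1 (z km.1 km.2)
    let F : ℕ × ℕ → B × ℕ := fun km => (W (Z km), ⌊((Z km).2 + C) / Real.pi⌋₊)
    have hZ0 : ∀ km, G (Z km) = 0 := fun km => (hz _ _).1.2
    have hZl : ∀ km, OnLink p q (Z km) := fun km => ⟨km.1, honlink _ _⟩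
    have hZ2 : ∀ km, 0 ≤ ((Z km).2 + C) / Real.pi ∧ ((Z km).2 + C) / Real.pi < km.2 + D := by
      intro km
      have h1 := (hz km.1 km.2).1.1
      have h2 := (abs_le.1 (hYb km.1 km.2)).1
      have h3 := (abs_le.1 (hYb km.1 (km.2 + r))).2
      have h4 : (Z km).2 = z km.1 km.2 := rfl
      push_cast at h2 h3
      have h5 : 0 ≤ Real.pi * km.2 := by positivity
      rw [div_add' _ _ _ hpi.ne', div_lt_iff₀ hpi] at hD
      rw [h4]
      constructor
      · apply div_nonneg _ hpi.le
        linarith [h1.1]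
      · rw [div_lt_iff₀ hpi]
        linarith [h1.2]
    have hmaps : ∀ km ∈ Finset.range p.natAbs ×ˢ Finset.range M,
        F km ∈ S ×ˢ Finset.range (M + D) := by
      intro km hkm
      rw [Finset.mem_product, Finset.mem_range, Finset.mem_range] at hkm
      rw [Finset.mem_product, Finset.mem_range]
      refine ⟨hW _ (hZl km) (hZ0 km), ?_⟩
      rw [Nat.floor_lt (hZ2 km).1]
      refine (hZ2 km).2.trans ?_
      have : (km.2 : ℝ) < M := by exact_mod_cast hkm.2
      push_cast
      linarith
    have hinj : Set.InjOn F (Finset.range p.natAbs ×ˢ Finset.range M : Finset (ℕ × ℕ)) := by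
      intro km hkm km' hkm' heq
      rw [Finset.mem_coe, Finset.mem_product, Finset.mem_range, Finset.mem_range] at hkm hkm'
      obtain ⟨i, j, hij, hP⟩ := hWi _ _ (hZl km) (hZl km') (hZ0 km) (hZ0 km')
        (congrArg Prod.fst heq)
      have hfl : ⌊((Z km).2 + C) / Real.pi⌋₊ = ⌊((Z km').2 + C) / Real.pi⌋₊ :=
        congrArg Prod.snd heq
      have e1 : (Z km').1 = (Z km).1 + Real.pi * i := congrArg Prod.fst hP
      have e2 : (Z km').2 = (Z km).2 + Real.pi * j := congrArg Prod.snd hP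
      have hj : j = 0 := by
        have e3 : ((Z km').2 + C) / Real.pi = ((Z km).2 + C) / Real.pi + j := by
          rw [e2]; field_simp; ring
        have h1 := Nat.floor_le (hZ2 km).1
        have h2 := Nat.lt_floor_add_one (((Z km).2 + C) / Real.pi)
        have h3 := Nat.floor_le (hZ2 km').1
        have h4 := Nat.lt_floor_add_one (((Z km').2 + C) / Real.pi)
        rw [← hfl, e3] at h3 h4
        have h5 : (j : ℝ) < 1 := by linarith
        have h6 : (-1 : ℝ) < j := by linarith
        have h5' : j < 1 := by exact_mod_cast h5
        have h6' : -1 < j := by exact_mod_cast h6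
        omega
      subst hj
      obtain ⟨l, hl⟩ := hij
      have h1 := honlink km.1 (z km.1 km.2)
      have h2 := honlink km'.1 (z km'.1 km'.2)
      have h3 : (p : ℝ) * l = km'.1 - km.1 := by
        have h4 : p * (Z km').1 - q * (Z km').2 = 2 * Real.pi * km'.1 := by exact_mod_cast h2
        have h5 : p * (Z km).1 - q * (Z km).2 = 2 * Real.pi * km.1 := by exact_mod_cast h1
        have h6 : (i : ℝ) = 2 * l := by
          have : i = 2 * l := by omega
          exact_mod_cast this
        rw [e1, e2, h6] at h4
        apply mul_left_cancel₀ (two_pos.trans_le (by linarith [Real.pi_gt_three]) :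
          (0 : ℝ) < 2 * Real.pi).ne'
        push_cast at h4
        linarith
      have h3' : p * l = (km'.1 : ℤ) - km.1 := by exact_mod_cast h3
      have hk : km.1 = km'.1 := by
        have habs : (p * l).natAbs < p.natAbs := by omega
        rw [Int.natAbs_mul] at habs
        have hl0 : l.natAbs = 0 := by
          by_contra hl0
          have := Nat.le_mul_of_pos_right p.natAbs (Nat.pos_of_ne_zero hl0)
          omega
        have : l = 0 := Int.natAbs_eq_zero.1 hl0
        subst this
        omega
      refine Prod.ext hk ?_
      have h7 : z km.1 km.2 = z km.1 km'.2 := by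
        have : (Z km').2 = (Z km).2 := by rw [e2]; simp
        simp only [Z, line, ← hk] at this
        exact this.symm
      exact_mod_cast hzinj' _ _ _ h7
    simpa using Finset.card_le_card_of_injOn F hmaps hinj
  by_contra hlt
  have h1 := hcount (S.card * D + 1)
  have h2 : S.card + 1 ≤ p.natAbs := by omega
  have h3 := Nat.mul_le_mul_right (S.card * D + 1) h2
  nlinarith

/-! ### The torus in four-space and homogeneous diffeomorphisms -/

/-- Euclidean four-space, with `ℝP³` as its space of lines. -/
abbrev R4 : Type := EuclideanSpace ℝ (Fin 4)

/-- The complex coordinate `z = v₀ + i v₁` on `ℝ⁴ = ℂ²`. -/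
def zCoord (v : R4) : ℂ := ⟨v 0, v 1⟩

/-- The complex coordinate `w = v₂ + i v₃` on `ℝ⁴ = ℂ²`. -/
def wCoord (v : R4) : ℂ := ⟨v 2, v 3⟩

/-- The point `(e^{ix}, e^{iy})` of the torus `|z| = |w| = 1`. -/
def torusPt (P : ℝ × ℝ) : R4 :=
  !₂[Real.cos P.1, Real.sin P.1, Real.cos P.2, Real.sin P.2]

@[simp] theorem torusPt_zero (P : ℝ × ℝ) : torusPt P 0 = Real.cos P.1 := rfl
@[simp] theorem torusPt_one (P : ℝ × ℝ) : torusPt P 1 = Real.sin P.1 := rfl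
@[simp] theorem torusPt_two (P : ℝ × ℝ) : torusPt P 2 = Real.cos P.2 := rfl
@[simp] theorem torusPt_three (P : ℝ × ℝ) : torusPt P 3 = Real.sin P.2 := rfl

theorem contDiff_torusPt : ContDiff ℝ ∞ torusPt := by
  rw [contDiff_euclidean]
  intro i
  fin_cases i
  · exact Real.contDiff_cos.comp contDiff_fst
  · exact Real.contDiff_sin.comp contDiff_fst
  · exact Real.contDiff_cos.comp contDiff_snd
  · exact Real.contDiff_sin.comp contDiff_snd

theorem ext_R4 {v w : R4} (h0 : v 0 = w 0) (h1 : v 1 = w 1) (h2 : v 2 = w 2) (h3 : v 3 = w 3) :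
    v = w := by
  ext i
  fin_cases i <;> assumption

theorem zCoord_torusPt (P : ℝ × ℝ) : zCoord (torusPt P) = Complex.exp (P.1 * Complex.I) := by
  apply Complex.ext
  · simp [zCoord, Complex.exp_ofReal_mul_I_re]
  · simp [zCoord, Complex.exp_ofReal_mul_I_im]

theorem wCoord_torusPt (P : ℝ × ℝ) : wCoord (torusPt P) = Complex.exp (P.2 * Complex.I) := by
  apply Complex.ext
  · simp [wCoord, Complex.exp_ofReal_mul_I_re]
  · simp [wCoord, Complex.exp_ofReal_mul_I_im]

theorem torusPt_ne_zero (P : ℝ × ℝ) : torusPt P ≠ 0 := by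
  intro h
  have := zCoord_torusPt P
  rw [h] at this
  exact Complex.exp_ne_zero _ (this.symm.trans (by apply Complex.ext <;> simp [zCoord]))

theorem torusPt_add_latt (P : ℝ × ℝ) (i j : ℤ) : torusPt (P + latt i j) = torusPt P := by
  apply ext_R4
  · simpa [mul_comm] using Real.cos_add_int_mul_two_pi P.1 i
  · simpa [mul_comm] using Real.sin_add_int_mul_two_pi P.1 i
  · simpa [mul_comm] using Real.cos_add_int_mul_two_pi P.2 j
  · simpa [mul_comm] using Real.sin_add_int_mul_two_pi P.2 j

theorem torusPt_add_halfPeriod (P : ℝ × ℝ) : torusPt (P + halfPeriod) = -torusPt P := by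
  apply ext_R4 <;> simp [halfPeriod]

theorem continuous_zCoord : Continuous zCoord := by
  have : zCoord = fun v => ((v 0 : ℝ) : ℂ) + (v 1 : ℝ) * Complex.I := by
    ext v; apply Complex.ext <;> simp [zCoord]
  rw [this]; fun_prop

theorem continuous_wCoord : Continuous wCoord := by
  have : wCoord = fun v => ((v 2 : ℝ) : ℂ) + (v 3 : ℝ) * Complex.I := by
    ext v; apply Complex.ext <;> simp [wCoord]
  rw [this]; fun_prop

theorem eq_zero_of_coord {v : R4} (hz : zCoord v = 0) (hw : wCoord v = 0) : v = 0 := by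
  have h1 := Complex.ext_iff.1 hz
  have h2 := Complex.ext_iff.1 hw
  exact ext_R4 h1.1 h1.2 h2.1 h2.2

/-- Polar coordinates on the cone `|z| = |w|`. -/
theorem smul_torusPt_arg {v : R4} (h : ‖zCoord v‖ = ‖wCoord v‖) :
    ‖zCoord v‖ • torusPt ((zCoord v).arg, (wCoord v).arg) = v := by
  apply ext_R4
  · simp; rfl
  · simp; rfl
  · simp [h]; rfl
  · simp [h]; rfl

/-- A pair of mutually inverse diffeomorphisms of `ℝ⁴ ∖ 0`, homogeneous for all real scalars and
extended by `0 ↦ 0`. -/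
structure IsHomogeneousDiffeo (H K : R4 → R4) : Prop where
  contDiffOn : ContDiffOn ℝ ∞ H {0}ᶜ
  contDiffOn_inv : ContDiffOn ℝ ∞ K {0}ᶜ
  map_smul : ∀ (c : ℝ) v, H (c • v) = c • H v
  inv_map_smul : ∀ (c : ℝ) v, K (c • v) = c • K v
  left_inv : ∀ v, K (H v) = v
  right_inv : ∀ v, H (K v) = v

namespace IsHomogeneousDiffeo

variable {H K : R4 → R4} (hHK : IsHomogeneousDiffeo H K)
include hHK

theorem map_zero : H 0 = 0 := by simpa using hHK.map_smul 0 0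

theorem inv_map_zero : K 0 = 0 := by simpa using hHK.inv_map_smul 0 0

theorem map_neg (v : R4) : H (-v) = -H v := by simpa using hHK.map_smul (-1) v

theorem map_ne_zero {v : R4} (hv : v ≠ 0) : H v ≠ 0 := fun h =>
  hv (by rw [← hHK.left_inv v, h, hHK.inv_map_zero])

theorem inv_map_ne_zero {v : R4} (hv : v ≠ 0) : K v ≠ 0 := fun h =>
  hv (by rw [← hHK.right_inv v, h, hHK.map_zero])

theorem contDiff_comp_torusPt : ContDiff ℝ ∞ fun P => H (torusPt P) :=
  contDiffOn_univ.1 (hHK.contDiffOn.comp contDiff_torusPt.contDiffOn fun P _ => torusPt_ne_zero P)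

end IsHomogeneousDiffeo

/-- The function on the torus whose zeros are the points mapped by `H` to the hyperplane
orthogonal to `u`. -/
def heightFn (H : R4 → R4) (u : R4) (P : ℝ × ℝ) : ℝ := inner ℝ u (H (torusPt P))

theorem IsHomogeneousDiffeo.isOddOnTorus {H K : R4 → R4} (hHK : IsHomogeneousDiffeo H K) (u : R4) :
    IsOddOnTorus (heightFn H u) where
  continuous := continuous_const.inner hHK.contDiff_comp_torusPt.continuous
  add_latt P i j := by simp only [heightFn, torusPt_add_latt]
  add_halfPeriod P := by
    simp only [heightFn, torusPt_add_halfPeriod, hHK.map_neg, inner_neg_right]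

open Complex in
/-- The linking number of a loop of class `(a, b)` on the torus with its antipode is `a b`. If the
loop lies in the half `⟪u, H v⟫ > 0` of the sphere, then its antipode lies in the other half, and
the linking number vanishes. The class dual to the antipodal loop appears in the proof as the
circle-valued function equal to `w ^ a` on the solid torus `|z| ≤ |w|` and homotopic to `z ^ b` on
the solid torus `|w| ≤ |z|`. -/
theorem IsHomogeneousDiffeo.mul_eq_zero_of_hasLoop {H K : R4 → R4}
    (hHK : IsHomogeneousDiffeo H K) {u : R4} {a b : ℤ}
    (h : HasLoop (heightFn H u ⁻¹' Set.Ioi 0) a b) : a * b = 0 := by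
  classical
  have hG := hHK.isOddOnTorus u
  set U := heightFn H u ⁻¹' Set.Ioi 0 with hUdef
  have hUo : IsOpen U := isOpen_Ioi.preimage hG.continuous
  obtain ⟨θ, hθc, hθp, hθx⟩ := exists_branch (hG.lattInvariant (Set.Ioi 0)) hUo (-b) a
    (fun a' b' h' => by have := hG.hasLoop_parallel h h'; linarith)
  let A : Set R4 := {y | 0 < inner ℝ u y}
  have hA0 : ∀ y : A, (y : R4) ≠ 0 := fun y h0 => by
    have : (0 : ℝ) < inner ℝ u (y : R4) := y.2
    rw [h0, inner_zero_right] at this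
    exact lt_irrefl _ this
  have hAo : IsOpen A := isOpen_lt continuous_const (continuous_const.inner continuous_id)
  have hAc : Convex ℝ A := convex_halfSpace_gt (innerₗ R4 u).isLinear 0
  obtain ⟨P₀, γ, hγ⟩ := h
  have hAne : A.Nonempty := ⟨H (torusPt (γ 0)), hγ 0⟩
  have : ContractibleSpace A := hAc.contractibleSpace hAne
  have : LocallyPathConnectedSpace A := hAo.locallyPathConnectedSpace
  let z : A → ℂ := fun y => zCoord (K y)
  let w : A → ℂ := fun y => wCoord (K y)
  have hKc : Continuous fun y : A => K y :=
    hHK.contDiffOn_inv.continuousOn.comp_continuous continuous_subtype_val fun y => hA0 y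
  have hz : Continuous z := continuous_zCoord.comp hKc
  have hw : Continuous w := continuous_wCoord.comp hKc
  have hzw0 : ∀ y : A, ¬(z y = 0 ∧ w y = 0) := fun y hy =>
    hHK.inv_map_ne_zero (hA0 y) (eq_zero_of_coord hy.1 hy.2)
  have hz0 : ∀ y : A, ‖w y‖ ≤ ‖z y‖ → z y ≠ 0 := fun y hy h0 => hzw0 y ⟨h0, by
    rw [h0, norm_zero] at hy; exact norm_le_zero_iff.1 hy⟩
  have hw0 : ∀ y : A, ‖z y‖ ≤ ‖w y‖ → w y ≠ 0 := fun y hy h0 => hzw0 y ⟨by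
    rw [h0, norm_zero] at hy; exact norm_le_zero_iff.1 hy, h0⟩
  -- the branch of `a y - b x` on the intersection with the torus, extended off the torus
  let T : Set A := {y | ‖z y‖ = ‖w y‖}
  have hT : IsClosed T := isClosed_eq hz.norm hw.norm
  let θT : A → ℝ := fun y => θ ((z y).arg, (w y).arg)
  have hTU : ∀ y ∈ T, ((z y).arg, (w y).arg) ∈ U := by
    intro y hy
    have h1 : ‖z y‖ • H (torusPt ((z y).arg, (w y).arg)) = y := by
      rw [← hHK.map_smul, smul_torusPt_arg hy, hHK.right_inv]
    have h2 : 0 < ‖z y‖ * heightFn H u ((z y).arg, (w y).arg) := by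
      rw [heightFn, ← real_inner_smul_right, h1]
      exact y.2
    exact pos_of_mul_pos_right h2 (norm_nonneg _)
  have hθT : ContinuousOn θT T := by
    intro y hy
    have hzy := hz0 y (le_of_eq hy.symm)
    have hwy := hw0 y (le_of_eq hy)
    let Q : A → ℝ × ℝ := fun y' =>
      ((z y).arg + (z y' / z y).arg, (w y).arg + (w y' / w y).arg)
    have hQ : ContinuousAt Q y := by
      have h1 : ContinuousAt (fun y' => (z y' / z y).arg) y :=
        ContinuousAt.comp (g := arg) (f := fun y' => z y' / z y)
          (continuousAt_arg (by simp [div_self hzy]))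
          (hz.continuousAt.div_const _)
      have h2 : ContinuousAt (fun y' => (w y' / w y).arg) y :=
        ContinuousAt.comp (g := arg) (f := fun y' => w y' / w y)
          (continuousAt_arg (by simp [div_self hwy]))
          (hw.continuousAt.div_const _)
      exact (continuousAt_const.add h1).prodMk (continuousAt_const.add h2)
    have hQy : Q y = ((z y).arg, (w y).arg) := by simp [Q, div_self hzy, div_self hwy]
    have hθQ : ContinuousAt (fun y' => θ (Q y')) y := by
      have h3 : ContinuousAt θ (Q y) := by
        rw [hQy]; exact hθc.continuousAt (hUo.mem_nhds (hTU y hy))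
      exact ContinuousAt.comp (f := Q) h3 hQ
    refine hθQ.continuousWithinAt.congr_of_eventuallyEq ?_ ?_
    · filter_upwards [self_mem_nhdsWithin] with y' hy'
      have hzy' := hz0 y' (le_of_eq hy'.symm)
      have hwy' := hw0 y' (le_of_eq hy')
      have e1 : ((z y').arg : Real.Angle) = ((z y).arg + (z y' / z y).arg : ℝ) := by
        rw [Real.Angle.coe_add, arg_div_coe_angle hzy' hzy]; abel
      have e2 : ((w y').arg : Real.Angle) = ((w y).arg + (w y' / w y).arg : ℝ) := by
        rw [Real.Angle.coe_add, arg_div_coe_angle hwy' hwy]; abel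
      obtain ⟨i, hi⟩ := Real.Angle.angle_eq_iff_two_pi_dvd_sub.1 e1.symm
      obtain ⟨j, hj⟩ := Real.Angle.angle_eq_iff_two_pi_dvd_sub.1 e2.symm
      have : Q y' = ((z y').arg, (w y').arg) + latt i j := by
        ext
        · simp [Q]; linarith
        · simp [Q]; linarith
      simp only [θT]
      rw [this, hθp _ (hTU y' hy')]
    · simp only [θT, hQy]
  obtain ⟨g, hg⟩ := ContinuousMap.exists_restrict_eq hT ⟨T.domRestrict θT, hθT.domRestrict⟩
  have hgT : ∀ y ∈ T, g y = θT y := fun y hy =>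
    congrArg (fun f : C(T, ℝ) => f ⟨y, hy⟩) hg
  -- the circle-valued function
  let D : A → ℂ := fun y => if ‖z y‖ ≤ ‖w y‖ then (w y / ‖w y‖) ^ a else
    (z y / ‖z y‖) ^ b * exp (g y * I)
  have hpolar : ∀ x : ℂ, x ≠ 0 → x / ‖x‖ = exp (x.arg * I) := fun x hx => by
    have h1 : (‖x‖ : ℂ) ≠ 0 := by simpa using hx
    rw [div_eq_iff h1, mul_comm]
    exact (norm_mul_exp_arg_mul_I x).symm
  have hDc : Continuous D := by
    refine continuous_if_le hz.norm hw.norm ?_ ?_ ?_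
    · refine ContinuousOn.zpow₀ (hw.continuousOn.div (by fun_prop) ?_) a ?_
      · intro y hy; simpa using hw0 y hy
      · intro y hy; left; simpa using hw0 y hy
    · refine ContinuousOn.mul (ContinuousOn.zpow₀ (hz.continuousOn.div (by fun_prop) ?_) b ?_)
        (by fun_prop)
      · intro y hy; simpa using hz0 y hy
      · intro y hy; left; simpa using hz0 y hy
    · intro y hy
      have hzy := hz0 y (le_of_eq hy.symm)
      have hwy := hw0 y (le_of_eq hy)
      obtain ⟨n, hn⟩ := hθx ((z y).arg, (w y).arg)
      rw [hpolar _ hzy, hpolar _ hwy, hgT y hy]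
      simp only [θT, hn]
      rw [← exp_int_mul, ← exp_int_mul, ← exp_add, exp_eq_exp_iff_exists_int]
      refine ⟨-n, ?_⟩
      push_cast
      ring
  have hD0 : ∀ y, D y ≠ 0 := by
    intro y
    simp only [D]
    split_ifs with hy
    · exact zpow_ne_zero _ (by simpa using hw0 y hy)
    · exact mul_ne_zero (zpow_ne_zero _ (by simpa using hz0 y (not_le.1 hy).le)) (exp_ne_zero _)
  obtain ⟨L, hL, hLD⟩ := exists_continuous_log hDc hD0
  -- the winding number of this function along the loop
  let y : unitInterval → A := fun t => ⟨H (torusPt (γ t)), hγ t⟩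
  have hy : Continuous y :=
    (hHK.contDiff_comp_torusPt.continuous.comp γ.continuous).subtype_mk _
  have hDy : ∀ t, D (y t) = exp ((a * (γ t).2 : ℝ) * I) := by
    intro t
    have h1 : z (y t) = exp ((γ t).1 * I) := by
      simp only [z, y, hHK.left_inv, zCoord_torusPt]
    have h2 : w (y t) = exp ((γ t).2 * I) := by
      simp only [w, y, hHK.left_inv, wCoord_torusPt]
    have h3 : ‖z (y t)‖ ≤ ‖w (y t)‖ := by
      rw [h1, h2, norm_exp_ofReal_mul_I, norm_exp_ofReal_mul_I]
    simp only [D, h3, if_true]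
    rw [h2, norm_exp_ofReal_mul_I, ofReal_one, div_one, ← exp_int_mul]
    push_cast
    ring_nf
  have hconst := eq_of_exp_eq (g := fun t => L (y t) - (a * (γ t).2 : ℝ) * I)
    ((hL.comp hy).sub (by fun_prop)) (fun s t => by
      rw [exp_sub, exp_sub, hLD, hLD, hDy, hDy, div_self (exp_ne_zero _),
        div_self (exp_ne_zero _)]) 0 1
  have hy01 : y 0 = y 1 := by
    apply Subtype.ext
    simp only [y, γ.source, γ.target, torusPt_add_latt]
  simp only [hy01, γ.source, γ.target] at hconst
  have h4 : ((a * P₀.2 : ℝ) : ℂ) = (a * (P₀ + latt a b).2 : ℝ) := by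
    apply mul_right_cancel₀ I_ne_zero
    linear_combination -hconst
  have h5 : a * P₀.2 = a * (P₀ + latt a b).2 := by exact_mod_cast h4
  have h6 : 2 * Real.pi * ((a : ℝ) * b) = 0 := by
    simp only [Prod.snd_add, latt_snd] at h5
    linear_combination -h5
  have h7 : (a : ℝ) * b = 0 := by
    rcases mul_eq_zero.1 h6 with h | h
    · exact absurd h (by positivity)
    · exact h
  exact_mod_cast h7

/-! ### Generic hyperplanes -/

theorem fderiv_add_latt {F : Type*} [NormedAddCommGroup F] [NormedSpace ℝ F] {G : ℝ × ℝ → F}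
    (hG : ∀ P i j, G (P + latt i j) = G P) (P : ℝ × ℝ) (i j : ℤ) :
    fderiv ℝ G (P + latt i j) = fderiv ℝ G P := by
  have h : (fun Q => G (Q + latt i j)) = G := funext fun Q => hG Q i j
  rw [← fderiv_comp_add_right, h]

/-- If `0` is a regular value, then a nontrivial loop in a small neighbourhood of `G ≥ 0` can be
pushed along the gradient into `G > 0`. -/
theorem IsOddOnTorus.exists_hasLoop_pos {G : ℝ × ℝ → ℝ} (hG : IsOddOnTorus G)
    (hsm : ContDiff ℝ ∞ G) (hreg : ∀ P, G P = 0 → fderiv ℝ G P ≠ 0) :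
    ∃ a b, ¬(a = 0 ∧ b = 0) ∧ HasLoop (G ⁻¹' Set.Ioi 0) a b := by
  let V : ℝ × ℝ → ℝ × ℝ := fun P => (fderiv ℝ G P (1, 0), fderiv ℝ G P (0, 1))
  have hdc : Continuous (fderiv ℝ G) := hsm.continuous_fderiv (by simp)
  have hV : Continuous V := by fun_prop
  have hVp : ∀ P i j, V (P + latt i j) = V P := fun P i j => by
    simp only [V, fderiv_add_latt hG.add_latt]
  let n : ℝ × ℝ → ℝ := fun P => (V P).1 ^ 2 + (V P).2 ^ 2
  have hn0 : ∀ P, 0 ≤ n P := fun P => by positivity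
  have hlin : ∀ P Q : ℝ × ℝ, fderiv ℝ G P Q = Q.1 * (V P).1 + Q.2 * (V P).2 := fun P Q => by
    have : Q = Q.1 • ((1, 0) : ℝ × ℝ) + Q.2 • ((0, 1) : ℝ × ℝ) := by ext <;> simp
    conv_lhs => rw [this, map_add, map_smul, map_smul]
    rfl
  let e : ℝ → ℝ × ℝ → ℝ := fun s P => fderiv ℝ G (P + s • V P) (V P)
  have hec : Continuous (Function.uncurry e) := by
    refine (hdc.comp ?_).clm_apply ?_ <;> fun_prop
  have he0 : ∀ P, e 0 P = n P := fun P => by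
    simp only [e, zero_smul, add_zero, hlin, n]; ring
  let Q : Set (ℝ × ℝ) := Set.Icc 0 (2 * Real.pi, 2 * Real.pi)
  have hQ : IsCompact Q := isCompact_Icc
  have hQne : Q.Nonempty := ⟨0, le_rfl, by constructor <;> simp <;> positivity⟩
  obtain ⟨P₁, -, hmin⟩ := hQ.exists_isMinOn hQne
    (f := fun P => max |G P| (n P)) ((hG.continuous.abs.max (by fun_prop)).continuousOn)
  -- `μ` is positive because `G` and its gradient have no common zero
  set μ := max |G P₁| (n P₁) with hμ
  have hμ0 : 0 < μ := by
    by_cases h0 : G P₁ = 0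
    · refine lt_max_of_lt_right (lt_of_le_of_ne (hn0 _) fun h => hreg _ h0 ?_)
      have h1 : (V P₁).1 = 0 := by
        simp only [n] at h
        nlinarith [sq_nonneg (V P₁).1, sq_nonneg (V P₁).2]
      have h2 : (V P₁).2 = 0 := by
        simp only [n] at h
        nlinarith [sq_nonneg (V P₁).1, sq_nonneg (V P₁).2]
      ext <;> simp [hlin, h1, h2]
    · exact lt_max_of_lt_left (abs_pos.2 h0)
  have hunif : ∀ᶠ s in nhds (0 : ℝ), ∀ P ∈ Q, |e s P - n P| < μ / 4 := by
    refine hQ.eventually_forall_of_forall_eventually fun P _ => ?_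
    have hc : Continuous fun z : ℝ × (ℝ × ℝ) => |e z.1 z.2 - n z.2| := by
      have : Continuous fun z : ℝ × (ℝ × ℝ) => e z.1 z.2 := hec
      fun_prop
    refine hc.continuousAt.eventually (gt_mem_nhds ?_)
    simp only [he0, sub_self, abs_zero]
    positivity
  obtain ⟨s₀, hs₀, hball⟩ := Metric.eventually_nhds_iff.1 hunif
  let s := min (s₀ / 2) 1
  have hs : 0 < s := by positivity
  have hs1 : s ≤ 1 := min_le_right _ _
  have hss₀ : s < s₀ := (min_le_left _ _).trans_lt (by linarith)
  have hpush : ∀ P ∈ Q, -(s * μ / 4) < G P → 0 < G (P + s • V P) := by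
    intro P hP hGP
    have hder : ∀ t, HasDerivAt (fun t => G (P + t • V P)) (e t P) t := by
      intro t
      have h1 : HasFDerivAt G (fderiv ℝ G (P + t • V P)) (P + t • V P) :=
        (hsm.differentiable (by simp) _).hasFDerivAt
      have h2 : HasDerivAt (fun t : ℝ => P + t • V P) (V P) t := by
        simpa using ((hasDerivAt_id t).smul_const (V P)).const_add P
      exact h1.comp_hasDerivAt t h2
    obtain ⟨t, ht, heq⟩ := exists_hasDerivAt_eq_slope _ _ hs
      (HasDerivAt.continuousOn fun t _ => hder t) (fun t _ => hder t)
    simp only [zero_smul, add_zero, sub_zero] at heq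
    have h3 := (abs_lt.1 (hball (y := t) (by
      rw [Real.dist_eq, sub_zero, abs_of_pos ht.1]; exact ht.2.trans hss₀) P hP)).1
    rw [eq_div_iff hs.ne'] at heq
    have h4 : μ ≤ max |G P| (n P) := hmin hP
    have h5 := hn0 P
    rcases le_max_iff.1 h4 with h6 | h6
    · have h7 : μ ≤ G P := by
        rcases le_abs.1 h6 with h | h
        · exact h
        · nlinarith
      nlinarith
    · nlinarith
  have hpush' : ∀ P, -(s * μ / 4) < G P → 0 < G (P + s • V P) := by
    intro P hP
    obtain ⟨i, j, hij⟩ := exists_add_latt_mem_Icc P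
    have := hpush _ hij (by rwa [hG.add_latt])
    rwa [hVp, add_right_comm, hG.add_latt] at this
  obtain ⟨a, b, hab, P, γ, hγ⟩ := hG.exists_hasLoop (δ := s * μ / 4) (by positivity)
  refine ⟨a, b, hab, P + s • V P, ?_⟩
  have hcont : Continuous fun P => P + s • V P := by fun_prop
  have e1 : P + s • V P + latt a b = (P + latt a b) + s • V (P + latt a b) := by
    rw [hVp]; abel
  rw [e1]
  exact ⟨γ.map (f := fun P => P + s • V P) hcont, fun t => hpush' _ (hγ t)⟩

/-- The vector of signed `3 × 3` minors of three vectors of `ℝ⁴`, which is orthogonal to them. -/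
def crossR4 (a b c : R4) : R4 :=
  WithLp.toLp 2 fun j => (-1) ^ (j : ℕ) *
    ((Matrix.of ![a.ofLp, b.ofLp, c.ofLp]).submatrix id j.succAbove).det

theorem inner_crossR4 (d a b c : R4) :
    inner ℝ d (crossR4 a b c) = (Matrix.of ![d.ofLp, a.ofLp, b.ofLp, c.ofLp]).det := by
  rw [Matrix.det_succ_row_zero, PiLp.inner_apply]
  refine Finset.sum_congr rfl fun j _ => ?_
  simp only [crossR4, RCLike.inner_apply, conj_trivial, Matrix.of_apply, Matrix.cons_val_zero]
  rw [mul_right_comm]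
  rfl

/-- A vector orthogonal to three linearly independent vectors of `ℝ⁴` is a multiple of their
cross product. -/
theorem exists_smul_crossR4 {u a b c : R4}
    (hi : ∀ x y z : ℝ, x • a + y • b + z • c = 0 → x = 0 ∧ y = 0 ∧ z = 0)
    (ha : inner ℝ u a = 0) (hb : inner ℝ u b = 0) (hc : inner ℝ u c = 0) :
    ∃ t : ℝ, u = t • crossR4 a b c := by
  by_cases hu : u = 0
  · exact ⟨0, by simp [hu]⟩
  have huu : inner ℝ u u ≠ (0 : ℝ) := inner_self_ne_zero.2 hu
  let M : Matrix (Fin 4) (Fin 4) ℝ := Matrix.of ![u.ofLp, a.ofLp, b.ofLp, c.ofLp]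
  have hM : M.det ≠ 0 := by
    intro h0
    obtain ⟨x, hx0, hx⟩ := Matrix.exists_vecMul_eq_zero_iff.2 h0
    have h1 : x 0 • u + (x 1 • a + x 2 • b + x 3 • c) = 0 := by
      ext j
      have := congrFun hx j
      simp [Matrix.vecMul, dotProduct, Fin.sum_univ_four, M] at this
      simp
      linarith
    have h2 : x 0 = 0 := by
      have := congrArg (inner ℝ u) h1
      simp only [inner_add_right, real_inner_smul_right, ha, hb, hc, inner_zero_right] at this
      simpa [hu] using this
    rw [h2, zero_smul, zero_add] at h1
    obtain ⟨h3, h4, h5⟩ := hi _ _ _ h1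
    exact hx0 (by ext j; fin_cases j <;> assumption)
  set N := crossR4 a b c with hN
  have hdet : ∀ d, inner ℝ d N = (Matrix.of ![d.ofLp, a.ofLp, b.ofLp, c.ofLp]).det :=
    fun d => inner_crossR4 d a b c
  have hNu : inner ℝ u N ≠ 0 := by rw [hdet]; exact hM
  have hNa : inner ℝ a N = 0 := by
    rw [hdet]; exact Matrix.det_zero_of_row_eq (i := 0) (j := 1) (by decide) rfl
  have hNb : inner ℝ b N = 0 := by
    rw [hdet]; exact Matrix.det_zero_of_row_eq (i := 0) (j := 2) (by decide) rfl
  have hNc : inner ℝ c N = 0 := by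
    rw [hdet]; exact Matrix.det_zero_of_row_eq (i := 0) (j := 3) (by decide) rfl
  let v : R4 := (inner ℝ u u : ℝ) • N - (inner ℝ u N : ℝ) • u
  have hv : ∀ d : R4, inner ℝ d N = (0 : ℝ) → inner ℝ u d = (0 : ℝ) → inner ℝ d v = (0 : ℝ) := by
    intro d h1 h2
    simp only [v, inner_sub_right, real_inner_smul_right, h1, real_inner_comm u d, h2]
    ring
  have hvu : inner ℝ u v = (0 : ℝ) := by
    simp only [v, inner_sub_right, real_inner_smul_right]
    ring
  have hdot : ∀ d : R4, d.ofLp ⬝ᵥ v.ofLp = inner ℝ d v := fun d => by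
    rw [PiLp.inner_apply]
    simp [dotProduct, mul_comm]
  have hv0 : v.ofLp = 0 := by
    refine Matrix.eq_zero_of_mulVec_eq_zero hM ?_
    ext i
    fin_cases i
    · exact (hdot u).trans hvu
    · exact (hdot a).trans (hv a hNa ha)
    · exact (hdot b).trans (hv b hNb hb)
    · exact (hdot c).trans (hv c hNc hc)
  have hv0' : v = 0 := by ext i; exact congrFun hv0 i
  refine ⟨inner ℝ u u / inner ℝ u N, ?_⟩
  have h6 : (inner ℝ u u : ℝ) • N = (inner ℝ u N : ℝ) • u := sub_eq_zero.1 hv0'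
  rw [div_eq_inv_mul, mul_smul, h6, smul_smul, inv_mul_cancel₀ hNu, one_smul]

theorem ContDiff.crossR4 {E : Type*} [NormedAddCommGroup E] [NormedSpace ℝ E] {n : WithTop ℕ∞}
    {a b c : E → R4} (ha : ContDiff ℝ n a) (hb : ContDiff ℝ n b) (hc : ContDiff ℝ n c) :
    ContDiff ℝ n fun x => crossR4 (a x) (b x) (c x) := by
  rw [contDiff_euclidean] at ha hb hc
  rw [contDiff_euclidean]
  intro j
  simp only [PlaneSection.crossR4, Matrix.det_fin_three, Matrix.submatrix_apply, Matrix.of_apply, id,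
    Matrix.cons_val]
  have := fun k : Fin 3 => ha (j.succAbove k)
  have := fun k : Fin 3 => hb (j.succAbove k)
  have := fun k : Fin 3 => hc (j.succAbove k)
  fun_prop

namespace IsHomogeneousDiffeo

variable {H K : R4 → R4} (hHK : IsHomogeneousDiffeo H K)
include hHK

/-- `H` is an immersion, also along the radial direction. -/
theorem linearIndependent_partials (P : ℝ × ℝ) (r s t : ℝ)
    (h : r • H (torusPt P) + s • fderiv ℝ (fun Q => H (torusPt Q)) P (1, 0) +
      t • fderiv ℝ (fun Q => H (torusPt Q)) P (0, 1) = 0) : r = 0 ∧ s = 0 ∧ t = 0 := by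
  set y := H (torusPt P) with hy
  have hy0 : y ≠ 0 := hHK.map_ne_zero (torusPt_ne_zero P)
  have hKd : HasFDerivAt K (fderiv ℝ K y) y :=
    ((hHK.contDiffOn_inv.contDiffAt (isOpen_compl_singleton.mem_nhds hy0)).differentiableAt
      (by simp)).hasFDerivAt
  have hΦ : HasFDerivAt (fun Q => H (torusPt Q)) (fderiv ℝ (fun Q => H (torusPt Q)) P) P :=
    (hHK.contDiff_comp_torusPt.differentiable (by simp) P).hasFDerivAt
  have h1 : fderiv ℝ K y y = torusPt P := by
    have h2 : HasDerivAt (fun t : ℝ => t • y) y 1 := by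
      simpa using (hasDerivAt_id (1 : ℝ)).smul_const y
    have h3 : HasDerivAt (fun t : ℝ => K (t • y)) (fderiv ℝ K y y) 1 := by
      refine HasFDerivAt.comp_hasDerivAt (1 : ℝ) ?_ h2
      rwa [one_smul]
    have h4 : HasDerivAt (fun t : ℝ => K (t • y)) (K y) 1 := by
      simp only [hHK.inv_map_smul]
      simpa using (hasDerivAt_id (1 : ℝ)).smul_const (K y)
    rw [h3.unique h4, hy, hHK.left_inv]
  have h5 : HasFDerivAt torusPt ((fderiv ℝ K y).comp
      (fderiv ℝ (fun Q => H (torusPt Q)) P)) P := by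
    have := HasFDerivAt.comp P hKd hΦ
    have e : K ∘ (fun Q => H (torusPt Q)) = torusPt := funext fun Q => hHK.left_inv _
    rwa [e] at this
  have h6 := congrArg (fderiv ℝ K y) h
  rw [(fderiv ℝ K y).map_zero] at h6
  simp only [map_add, ContinuousLinearMap.map_smul, h1] at h6
  have h7 : ∀ i : Fin 4, HasFDerivAt (fun Q => torusPt Q i)
      ((EuclideanSpace.proj i : R4 →L[ℝ] ℝ).comp ((fderiv ℝ K y).comp
      (fderiv ℝ (fun Q => H (torusPt Q)) P))) P := fun i =>
    (EuclideanSpace.proj i : R4 →L[ℝ] ℝ).hasFDerivAt.comp P h5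
  have d0 : HasFDerivAt (fun Q : ℝ × ℝ => torusPt Q 0)
      (-Real.sin P.1 • ContinuousLinearMap.fst ℝ ℝ ℝ) P := (hasFDerivAt_fst (p := P)).cos
  have d1 : HasFDerivAt (fun Q : ℝ × ℝ => torusPt Q 1)
      (Real.cos P.1 • ContinuousLinearMap.fst ℝ ℝ ℝ) P := (hasFDerivAt_fst (p := P)).sin
  have d2 : HasFDerivAt (fun Q : ℝ × ℝ => torusPt Q 2)
      (-Real.sin P.2 • ContinuousLinearMap.snd ℝ ℝ ℝ) P := (hasFDerivAt_snd (p := P)).cos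
  have d3 : HasFDerivAt (fun Q : ℝ × ℝ => torusPt Q 3)
      (Real.cos P.2 • ContinuousLinearMap.snd ℝ ℝ ℝ) P := (hasFDerivAt_snd (p := P)).sin
  have c : ∀ (i : Fin 4) (v : ℝ × ℝ), (fderiv ℝ K y (fderiv ℝ (fun Q => H (torusPt Q)) P v)) i =
      ((EuclideanSpace.proj i : R4 →L[ℝ] ℝ).comp ((fderiv ℝ K y).comp
      (fderiv ℝ (fun Q => H (torusPt Q)) P))) v := fun i v => rfl
  have q := fun i : Fin 4 => congrArg (fun v : R4 => v i) h6
  have q0 := q 0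
  have q1 := q 1
  have q2 := q 2
  have q3 := q 3
  simp only [PiLp.add_apply, PiLp.smul_apply, PiLp.zero_apply, smul_eq_mul, c] at q0 q1 q2 q3
  rw [(h7 0).unique d0] at q0
  rw [(h7 1).unique d1] at q1
  rw [(h7 2).unique d2] at q2
  rw [(h7 3).unique d3] at q3
  simp at q0 q1 q2 q3
  have t1 := Real.sin_sq_add_cos_sq P.1
  have t2 := Real.sin_sq_add_cos_sq P.2
  refine ⟨?_, ?_, ?_⟩
  · linear_combination Real.cos P.1 * q0 + Real.sin P.1 * q1 - r * t1
  · linear_combination -Real.sin P.1 * q0 + Real.cos P.1 * q1 - s * t1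
  · linear_combination -Real.sin P.2 * q2 + Real.cos P.2 * q3 - t * t2

theorem contDiff_heightFn (u : R4) : ContDiff ℝ ∞ (heightFn H u) :=
  contDiff_const.inner ℝ hHK.contDiff_comp_torusPt

theorem fderiv_heightFn (u : R4) (P v : ℝ × ℝ) :
    fderiv ℝ (heightFn H u) P v = inner ℝ u (fderiv ℝ (fun Q => H (torusPt Q)) P v) := by
  have hΦ : HasFDerivAt (fun Q => H (torusPt Q)) (fderiv ℝ (fun Q => H (torusPt Q)) P) P :=
    (hHK.contDiff_comp_torusPt.differentiable (by simp) P).hasFDerivAt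
  have h := (innerSL ℝ u).hasFDerivAt.comp P hΦ
  have e : heightFn H u = (innerSL ℝ u) ∘ fun Q => H (torusPt Q) := rfl
  rw [e, h.fderiv]
  rfl

/-- The hyperplanes tangent to the image of the torus form a surface in the three-dimensional
dual projective space, so a generic hyperplane is transverse to the image of the torus. -/
theorem dense_regular :
    Dense {u : R4 | ∀ P, heightFn H u P = 0 → fderiv ℝ (heightFn H u) P ≠ 0} := by
  let Φ : ℝ × ℝ → R4 := fun Q => H (torusPt Q)
  have hΦ : ContDiff ℝ ∞ Φ := hHK.contDiff_comp_torusPt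
  have hd : ContDiff ℝ 1 (fderiv ℝ Φ) := hΦ.fderiv_right (by norm_cast)
  let F : ℝ × (ℝ × ℝ) → R4 := fun z =>
    z.1 • crossR4 (Φ z.2) (fderiv ℝ Φ z.2 (1, 0)) (fderiv ℝ Φ z.2 (0, 1))
  have hF : ContDiff ℝ 1 F := by
    refine contDiff_fst.smul (ContDiff.crossR4 ?_ ?_ ?_)
    · exact (hΦ.of_le (by norm_cast)).comp contDiff_snd
    · exact (hd.comp contDiff_snd).clm_apply contDiff_const
    · exact (hd.comp contDiff_snd).clm_apply contDiff_const
  refine (hF.dense_compl_range_of_finrank_lt_finrank (by simp)).mono ?_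
  intro u hu P hP hdP
  refine hu ?_
  have h1 : ∀ v, inner ℝ u (fderiv ℝ Φ P v) = (0 : ℝ) := fun v => by
    rw [← hHK.fderiv_heightFn, hdP]; rfl
  obtain ⟨t, ht⟩ := exists_smul_crossR4 (hHK.linearIndependent_partials P) hP (h1 _) (h1 _)
  exact ⟨(t, P), ht.symm⟩

end IsHomogeneousDiffeo

/-! ### Tilting a transverse hyperplane -/

/-- Two pairs of angles give the same point of the torus in `ℝP³`. -/
def AntipodalEq (P P' : ℝ × ℝ) : Prop :=
  ∃ i j : ℤ, 2 ∣ i - j ∧ P' = P + (Real.pi * i, Real.pi * j)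

namespace AntipodalEq

theorem symm {P P' : ℝ × ℝ} (h : AntipodalEq P P') : AntipodalEq P' P := by
  obtain ⟨i, j, hij, rfl⟩ := h
  exact ⟨-i, -j, by omega, by ext <;> simp⟩

theorem trans {P P' P'' : ℝ × ℝ} (h : AntipodalEq P P') (h' : AntipodalEq P' P'') :
    AntipodalEq P P'' := by
  obtain ⟨i, j, hij, rfl⟩ := h
  obtain ⟨i', j', hij', rfl⟩ := h'
  exact ⟨i + i', j + j', by omega, by ext <;> simp <;> ring⟩

theorem add_latt (P : ℝ × ℝ) (i j : ℤ) : AntipodalEq P (P + latt i j) :=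
  ⟨2 * i, 2 * j, by omega, by ext <;> simp <;> ring⟩

theorem add_halfPeriod (P : ℝ × ℝ) : AntipodalEq P (P + halfPeriod) :=
  ⟨1, 1, by simp, by ext <;> simp [halfPeriod]⟩

theorem torusPt_eq {P P' : ℝ × ℝ} (h : AntipodalEq P P') :
    torusPt P' = torusPt P ∨ torusPt P' = -torusPt P := by
  obtain ⟨i, j, ⟨l, hl⟩, rfl⟩ := h
  obtain ⟨m, rfl⟩ | ⟨m, rfl⟩ := Int.even_or_odd j
  · left
    have e : P + (Real.pi * i, Real.pi * (m + m : ℤ)) = P + latt (l + m) m := by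
      have : i = 2 * l + 2 * m := by omega
      ext
      · simp [this]; ring
      · simp; ring
    rw [e, torusPt_add_latt]
  · right
    have e : P + (Real.pi * i, Real.pi * (2 * m + 1 : ℤ)) = P + halfPeriod + latt (l + m) m := by
      have : i = 2 * l + 2 * m + 1 := by omega
      ext
      · simp [this, halfPeriod]; ring
      · simp [halfPeriod]; ring
    rw [e, torusPt_add_latt, torusPt_add_halfPeriod]

theorem onLink {p q : ℤ} (hpq : p ≡ q [ZMOD 2]) {P P' : ℝ × ℝ} (h : AntipodalEq P P')
    (hP : OnLink p q P) : OnLink p q P' := by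
  obtain ⟨i, j, ⟨l, hl⟩, rfl⟩ := h
  obtain ⟨k, hk⟩ := hP
  obtain ⟨m, hm⟩ := (Int.modEq_iff_dvd.1 hpq.symm)
  refine ⟨k + (l * p + j * m), ?_⟩
  have e1 : (i : ℝ) = 2 * l + j := by
    have : i = 2 * l + j := by omega
    exact_mod_cast this
  have e2 : (p : ℝ) = q + 2 * m := by
    have : p = q + 2 * m := by omega
    exact_mod_cast this
  push_cast
  simp only [Prod.fst_add, Prod.snd_add]
  rw [e1]
  linear_combination hk + Real.pi * j * e2

theorem heightFn_eq_zero {H K : R4 → R4} (hHK : IsHomogeneousDiffeo H K) {u : R4} {P P' : ℝ × ℝ}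
    (h : AntipodalEq P P') (hP : heightFn H u P = 0) : heightFn H u P' = 0 := by
  simp only [heightFn] at hP ⊢
  rcases h.torusPt_eq with h | h
  · rwa [h]
  · rw [h, hHK.map_neg, inner_neg_right, hP, neg_zero]

end AntipodalEq

theorem antipodalEq_of_torusPt_eq {P P' : ℝ × ℝ}
    (h : torusPt P' = torusPt P ∨ torusPt P' = -torusPt P) : AntipodalEq P P' := by
  have key : ∀ P P' : ℝ × ℝ, torusPt P' = torusPt P → AntipodalEq P P' := by
    intro P P' h
    have h0 := congrArg zCoord h
    have h1 := congrArg wCoord h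
    rw [zCoord_torusPt, zCoord_torusPt, Complex.exp_eq_exp_iff_exists_int] at h0
    rw [wCoord_torusPt, wCoord_torusPt, Complex.exp_eq_exp_iff_exists_int] at h1
    obtain ⟨i, hi⟩ := h0
    obtain ⟨j, hj⟩ := h1
    have hi' := congrArg Complex.im hi
    have hj' := congrArg Complex.im hj
    simp at hi' hj'
    have : P' = P + latt i j := by
      ext
      · simp [hi']; ring
      · simp [hj']; ring
    rw [this]
    exact AntipodalEq.add_latt P i j
  rcases h with h | h
  · exact key P P' h
  · rw [← torusPt_add_halfPeriod] at h
    exact (AntipodalEq.add_halfPeriod P).trans (key _ _ h)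

theorem isClosed_onLink (p q : ℤ) : IsClosed {P | OnLink p q P} := by
  have h : {P | OnLink p q P} = (fun P : ℝ × ℝ => (p * P.1 - q * P.2) / (2 * Real.pi)) ⁻¹'
      Set.range ((↑) : ℤ → ℝ) := by
    ext P
    simp only [OnLink, Set.mem_preimage, Set.mem_range]
    refine exists_congr fun k => ?_
    rw [eq_div_iff (by positivity)]
    constructor <;> intro h <;> linarith
  rw [h]
  exact Int.isClosedEmbedding_coe_real.isClosed_range.preimage (by fun_prop)

/-- Near each of its points, the torus link consists of a single line segment. -/
theorem OnLink.exists_eq_add_smul {p q : ℤ} (hq : q ≠ 0) {P : ℝ × ℝ} (hP : OnLink p q P) :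
    ∃ r > 0, ∀ P', OnLink p q P' → dist P' P < r →
      ∃ t : ℝ, |t| ≤ dist P' P ∧ P' = P + t • ((q : ℝ), (p : ℝ)) := by
  obtain ⟨k, hk⟩ := hP
  have hden : (0 : ℝ) < |(p : ℝ)| + |(q : ℝ)| + 1 := by positivity
  refine ⟨1 / (|(p : ℝ)| + |(q : ℝ)| + 1), by positivity, fun P' hP' hd => ?_⟩
  obtain ⟨k', hk'⟩ := hP'
  have hqR : (q : ℝ) ≠ 0 := by exact_mod_cast hq
  have hd1 : |P'.1 - P.1| ≤ dist P' P := by rw [dist_eq_norm]; exact norm_fst_le (P' - P)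
  have hd2 : |P'.2 - P.2| ≤ dist P' P := by rw [dist_eq_norm]; exact norm_snd_le (P' - P)
  rw [lt_div_iff₀ hden] at hd
  have hd0 := dist_nonneg (x := P') (y := P)
  have e : p * (P'.1 - P.1) - q * (P'.2 - P.2) = 2 * Real.pi * (k' - k) := by linarith
  have h1 : |2 * Real.pi * ((k' : ℝ) - k)| < 1 := by
    rw [← e]
    refine (abs_sub _ _).trans_lt ?_
    rw [abs_mul, abs_mul]
    nlinarith [mul_le_mul_of_nonneg_left hd1 (abs_nonneg (p : ℝ)),
      mul_le_mul_of_nonneg_left hd2 (abs_nonneg (q : ℝ))]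
  have h2 : k' = k := by
    have h3 : |((k' - k : ℤ) : ℝ)| < 1 := by
      rw [abs_mul, abs_of_pos (by positivity : 0 < 2 * Real.pi)] at h1
      push_cast
      nlinarith [Real.pi_gt_three, abs_nonneg ((k' : ℝ) - k)]
    have h4 : |k' - k| < 1 := by exact_mod_cast h3
    have := Int.abs_lt_one_iff.1 h4
    omega
  rw [h2, sub_self, mul_zero] at e
  refine ⟨(P'.1 - P.1) / q, ?_, ?_⟩
  · rw [abs_div]
    refine (div_le_self (abs_nonneg _) ?_).trans hd1
    exact_mod_cast Int.one_le_abs hq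
  · ext
    · simp; field_simp; ring
    · simp; field_simp; linarith

namespace IsHomogeneousDiffeo

variable {H K : R4 → R4} (hHK : IsHomogeneousDiffeo H K)
include hHK

theorem continuous_heightFn : Continuous fun z : R4 × (ℝ × ℝ) => heightFn H z.1 z.2 :=
  continuous_fst.inner (hHK.contDiff_comp_torusPt.continuous.comp continuous_snd)

/-- A simple zero on the link stays isolated when the hyperplane is tilted. -/
theorem exists_radius {p q : ℤ} (hq : q ≠ 0) {u₀ : R4} {P : ℝ × ℝ} (hP : OnLink p q P)
    (htr : fderiv ℝ (heightFn H u₀) P ((q : ℝ), (p : ℝ)) ≠ 0) :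
    ∃ r > 0, ∀ u, dist u u₀ < r → ∀ P' P'', OnLink p q P' → OnLink p q P'' → dist P' P < r →
      dist P'' P < r → heightFn H u P' = 0 → heightFn H u P'' = 0 → P' = P'' := by
  set D : ℝ × ℝ := ((q : ℝ), (p : ℝ)) with hD
  obtain ⟨r₁, hr₁, hline⟩ := hP.exists_eq_add_smul hq
  let d : R4 × ℝ → ℝ := fun z => fderiv ℝ (heightFn H z.1) (P + z.2 • D) D
  have hd : Continuous d := by
    have h1 : Continuous (fderiv ℝ fun Q => H (torusPt Q)) :=
      hHK.contDiff_comp_torusPt.continuous_fderiv (by simp)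
    simp only [d, hHK.fderiv_heightFn]
    refine continuous_fst.inner (Continuous.clm_apply (h1.comp (by fun_prop)) continuous_const)
  have hd0 : d (u₀, 0) ≠ 0 := by simpa [d] using htr
  obtain ⟨r₂, hr₂, hball⟩ := Metric.eventually_nhds_iff.1
    (hd.continuousAt.eventually_ne hd0)
  refine ⟨min r₁ r₂, by positivity, fun u hu P' P'' hP' hP'' hd' hd'' h0' h0'' => ?_⟩
  obtain ⟨t', ht', rfl⟩ := hline P' hP' (hd'.trans_le (min_le_left _ _))
  obtain ⟨t'', ht'', rfl⟩ := hline P'' hP'' (hd''.trans_le (min_le_left _ _))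
  have ht'r := ht'.trans_lt (hd'.trans_le (min_le_right _ _))
  have ht''r := ht''.trans_lt (hd''.trans_le (min_le_right _ _))
  have key : ∀ s t : ℝ, |s| < r₂ → |t| < r₂ → heightFn H u (P + s • D) = 0 →
      heightFn H u (P + t • D) = 0 → ¬ s < t := by
    intro s t hs ht h0 h1 hlt
    have hder : ∀ τ, HasDerivAt (fun τ : ℝ => heightFn H u (P + τ • D)) (d (u, τ)) τ := by
      intro τ
      have h1 : HasFDerivAt (heightFn H u) (fderiv ℝ (heightFn H u) (P + τ • D)) (P + τ • D) :=
        ((hHK.contDiff_heightFn u).differentiable (by simp) _).hasFDerivAt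
      have h2 : HasDerivAt (fun τ : ℝ => P + τ • D) D τ := by
        simpa using ((hasDerivAt_id τ).smul_const D).const_add P
      exact h1.comp_hasDerivAt τ h2
    obtain ⟨τ, hτ, h2⟩ := exists_hasDerivAt_eq_zero hlt
      (HasDerivAt.continuousOn fun τ _ => hder τ) (h0.trans h1.symm) (fun τ _ => hder τ)
    refine hball (y := (u, τ)) ?_ h2
    rw [Prod.dist_eq]
    refine max_lt (hu.trans_le (min_le_right _ _)) ?_
    rw [Real.dist_eq, sub_zero, abs_lt]
    exact ⟨(neg_lt_of_abs_lt hs).trans hτ.1, hτ.2.trans (lt_of_abs_lt ht)⟩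
  have : t' = t'' := le_antisymm (not_lt.1 (key _ _ ht''r ht'r h0'' h0'))
    (not_lt.1 (key _ _ ht'r ht''r h0' h0''))
  rw [this]

/-- If the hyperplane orthogonal to `u₀` is transverse to the image of the link, then nearby
hyperplanes do not meet the image of the link in more points. -/
theorem eventually_exists_injection {p q : ℤ} (hq : q ≠ 0) (hpq : p ≡ q [ZMOD 2]) {u₀ : R4}
    (htr : ∀ P, OnLink p q P → heightFn H u₀ P = 0 →
      fderiv ℝ (heightFn H u₀) P ((q : ℝ), (p : ℝ)) ≠ 0)
    {B : Type*} (S : Finset B) (W : ℝ × ℝ → B)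
    (hW : ∀ P, OnLink p q P → heightFn H u₀ P = 0 → W P ∈ S)
    (hWi : ∀ P P', W P = W P' → AntipodalEq P P') :
    ∀ᶠ u in nhds u₀, ∃ W' : ℝ × ℝ → B,
      (∀ P, OnLink p q P → heightFn H u P = 0 → W' P ∈ S) ∧
      ∀ P P', OnLink p q P → OnLink p q P' → heightFn H u P = 0 → heightFn H u P' = 0 →
        W' P = W' P' → AntipodalEq P P' := by
  classical
  let Zr : B → ℝ × ℝ → Prop := fun x P => W P = x ∧ OnLink p q P ∧ heightFn H u₀ P = 0
  have hrad : ∀ x : B, ∃ (P : ℝ × ℝ) (r : ℝ), 0 < r ∧ ((∃ P, Zr x P) → Zr x P) ∧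
      ((∃ P, Zr x P) → ∀ u, dist u u₀ < r → ∀ P' P'', OnLink p q P' → OnLink p q P'' →
        dist P' P < r → dist P'' P < r → heightFn H u P' = 0 → heightFn H u P'' = 0 →
        P' = P'') := by
    intro x
    by_cases hx : ∃ P, Zr x P
    · obtain ⟨P, hP⟩ := hx
      obtain ⟨r, hr, h⟩ := hHK.exists_radius hq hP.2.1 (htr P hP.2.1 hP.2.2)
      exact ⟨P, r, hr, fun _ => hP, fun _ => h⟩
    · exact ⟨0, 1, one_pos, fun h => absurd h hx, fun h => absurd h hx⟩
  choose P₀ r hr hP₀ huniq using hrad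
  -- the points of the link near one of the zeros, modulo periods
  let N : Set (ℝ × ℝ) := ⋃ (x : B) (_ : ∃ P, Zr x P) (i : ℤ) (j : ℤ) (_ : 2 ∣ i - j),
    (fun P => P + ((Real.pi * i, Real.pi * j) : ℝ × ℝ)) ⁻¹' Metric.ball (P₀ x) (r x)
  have hN : IsOpen N := by
    refine isOpen_iUnion fun x => isOpen_iUnion fun _ => isOpen_iUnion fun i =>
      isOpen_iUnion fun j => isOpen_iUnion fun _ => ?_
    exact Metric.isOpen_ball.preimage (by fun_prop)
  have hNmem : ∀ P, P ∈ N ↔ ∃ x, (∃ P, Zr x P) ∧ ∃ P', AntipodalEq P P' ∧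
      dist P' (P₀ x) < r x := by
    intro P
    simp only [N, Set.mem_iUnion, Set.mem_preimage, Metric.mem_ball, AntipodalEq]
    constructor
    · rintro ⟨x, hx, i, j, hij, h⟩
      exact ⟨x, hx, _, ⟨i, j, hij, rfl⟩, h⟩
    · rintro ⟨x, hx, _, ⟨i, j, hij, rfl⟩, h⟩
      exact ⟨x, hx, i, j, hij, h⟩
  let Q : Set (ℝ × ℝ) := (Set.Icc 0 (2 * Real.pi, 2 * Real.pi) ∩ {P | OnLink p q P}) \ N
  have hQ : IsCompact Q := (isCompact_Icc.inter_right (isClosed_onLink p q)).diff hN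
  have hQ0 : ∀ P ∈ Q, heightFn H u₀ P ≠ 0 := by
    intro P hP h0
    refine hP.2 ((hNmem P).2 ?_)
    have hx : ∃ P', Zr (W P) P' := ⟨P, rfl, hP.1.2, h0⟩
    refine ⟨W P, hx, P₀ (W P), hWi _ _ (hP₀ _ hx).1.symm, ?_⟩
    rw [dist_self]
    exact hr _
  have hev1 : ∀ᶠ u in nhds u₀, ∀ P ∈ Q, heightFn H u P ≠ 0 := by
    refine hQ.eventually_forall_of_forall_eventually fun P hP => ?_
    exact hHK.continuous_heightFn.continuousAt.eventually_ne (hQ0 P hP)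
  have hev2 : ∀ᶠ u in nhds u₀, ∀ x ∈ S, dist u u₀ < r x := by
    rw [Filter.eventually_all_finset]
    exact fun x _ => Metric.ball_mem_nhds u₀ (hr x)
  filter_upwards [hev1, hev2] with u hu1 hu2
  have hxS : ∀ x, (∃ P, Zr x P) → x ∈ S := fun x ⟨P, hP⟩ => hP.1 ▸ hW P hP.2.1 hP.2.2
  have hnear : ∀ P, OnLink p q P → heightFn H u P = 0 →
      ∃ x, (∃ P, Zr x P) ∧ ∃ P', AntipodalEq P P' ∧ dist P' (P₀ x) < r x := by
    intro P hP h0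
    obtain ⟨i, j, hij⟩ := exists_add_latt_mem_Icc P
    have ha := AntipodalEq.add_latt P i j
    by_cases hPN : P + latt i j ∈ N
    · obtain ⟨x, hx, P', hP', hd⟩ := (hNmem _).1 hPN
      exact ⟨x, hx, P', ha.trans hP', hd⟩
    · exact absurd (ha.heightFn_eq_zero hHK h0) (hu1 _ ⟨⟨hij, ha.onLink hpq hP⟩, hPN⟩)
  refine ⟨fun P => if h : OnLink p q P ∧ heightFn H u P = 0 then (hnear P h.1 h.2).choose
    else W P, ?_, ?_⟩
  · intro P hP h0
    simp only [hP, h0, and_self, dif_pos]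
    exact hxS _ (hnear P hP h0).choose_spec.1
  · intro P P' hP hP' h0 h0' heq
    simp only [hP, h0, hP', h0', and_self, dif_pos] at heq
    obtain ⟨hx, P₁, hP₁, hd₁⟩ := (hnear P hP h0).choose_spec
    obtain ⟨hx', P₁', hP₁', hd₁'⟩ := (hnear P' hP' h0').choose_spec
    rw [← heq] at hd₁'
    have := huniq _ hx u (hu2 _ (hxS _ hx)) P₁ P₁' (hP₁.onLink hpq hP) (hP₁'.onLink hpq hP')
      hd₁ hd₁' (hP₁.heightFn_eq_zero hHK h0) (hP₁'.heightFn_eq_zero hHK h0')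
    exact hP₁.trans (this ▸ hP₁'.symm)

end IsHomogeneousDiffeo

theorem IsOddOnTorus.swap {G : ℝ × ℝ → ℝ} (hG : IsOddOnTorus G) :
    IsOddOnTorus fun P => G P.swap where
  continuous := hG.continuous.comp continuous_swap
  add_latt P i j := by rw [← hG.add_latt P.swap j i]; rfl
  add_halfPeriod P := hG.add_halfPeriod P.swap

theorem HasLoop.swap {G : ℝ × ℝ → ℝ} {s : Set ℝ} {a b : ℤ} (h : HasLoop (G ⁻¹' s) a b) :
    HasLoop ((fun P => G P.swap) ⁻¹' s) b a := by
  obtain ⟨P, γ, hγ⟩ := h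
  exact ⟨P.swap, γ.map continuous_swap, fun t => hγ t⟩

theorem OnLink.swap {p q : ℤ} {P : ℝ × ℝ} (h : OnLink q p P) : OnLink p q P.swap := by
  obtain ⟨k, hk⟩ := h
  refine ⟨-k, ?_⟩
  simp
  linarith

/-- A hyperplane transverse to the image of the torus link meets it in at least
`min |p| |q|` pairs of antipodal points. -/
theorem IsHomogeneousDiffeo.min_natAbs_le_card {H K : R4 → R4} (hHK : IsHomogeneousDiffeo H K)
    {p q : ℤ} (hp : p ≠ 0) (hq : q ≠ 0) (hpq : p ≡ q [ZMOD 2]) {u₀ : R4}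
    (htr : ∀ P, OnLink p q P → heightFn H u₀ P = 0 →
      fderiv ℝ (heightFn H u₀) P ((q : ℝ), (p : ℝ)) ≠ 0)
    {B : Type*} (S : Finset B) (W : ℝ × ℝ → B)
    (hW : ∀ P, OnLink p q P → heightFn H u₀ P = 0 → W P ∈ S)
    (hWi : ∀ P P', W P = W P' → AntipodalEq P P') :
    min p.natAbs q.natAbs ≤ S.card := by
  obtain ⟨u, hreg, W', hW', hWi'⟩ := hHK.dense_regular.inter_nhds_nonempty
    (hHK.eventually_exists_injection hq hpq htr S W hW hWi)
  have hG := hHK.isOddOnTorus u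
  obtain ⟨a, b, hab, hloop⟩ := hG.exists_hasLoop_pos (hHK.contDiff_heightFn u) hreg
  rcases mul_eq_zero.1 (hHK.mul_eq_zero_of_hasLoop hloop) with h | h
  · subst h
    have hb : b ≠ 0 := fun hb => hab ⟨rfl, hb⟩
    refine (min_le_right _ _).trans (hG.swap.natAbs_le_card hb hloop.swap hq p S
      (fun P => W' P.swap) (fun P hP h0 => hW' _ hP.swap h0) ?_)
    intro P P' hP hP' h0 h0' heq
    obtain ⟨i, j, hij, h⟩ := hWi' _ _ hP.swap hP'.swap h0 h0' heq
    refine ⟨j, i, by omega, ?_⟩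
    rw [← P'.swap_swap, h]
    rfl
  · subst h
    have ha : a ≠ 0 := fun ha => hab ⟨ha, rfl⟩
    exact (min_le_left _ _).trans (hG.natAbs_le_card ha hloop hp q S W' hW' hWi')

/-! ### Lifting an isotopy to four-space -/

/-- The line through a nonzero vector, as a point of projective space. The value at `0` is
arbitrary. -/
def lineOf (v : R4) : RealProj 3 :=
  if h : v ≠ 0 then RealProj.mk ⟨v, h⟩ else RealProj.mk ⟨torusPt 0, torusPt_ne_zero 0⟩

theorem lineOf_of_ne_zero {v : R4} (h : v ≠ 0) : lineOf v = RealProj.mk ⟨v, h⟩ := dif_pos h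

theorem lineOf_rep (x : RealProj 3) : lineOf x.rep = x := by
  rw [lineOf_of_ne_zero x.rep_ne_zero, x.mk_rep]

theorem lineOf_eq_iff {v w : R4} (hv : v ≠ 0) (hw : w ≠ 0) :
    lineOf v = lineOf w ↔ ∃ a : ℝ, a • w = v := by
  rw [lineOf_of_ne_zero hv, lineOf_of_ne_zero hw, RealProj.mk_eq_mk_iff]

theorem lineOf_smul {c : ℝ} (hc : c ≠ 0) (v : R4) : lineOf (c • v) = lineOf v := by
  by_cases hv : v = 0
  · simp [hv]
  · exact (lineOf_eq_iff (smul_ne_zero hc hv) hv).2 ⟨c, rfl⟩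

theorem exists_rep_lineOf {v : R4} (hv : v ≠ 0) : ∃ a : ℝ, a ≠ 0 ∧ (lineOf v).rep = a • v := by
  rw [lineOf_of_ne_zero hv]
  exact RealProj.exists_smul_rep_mk ⟨v, hv⟩

theorem affineChart_lineOf (i : Fin 4) {v : R4} (hv : v ≠ 0) :
    RealProj.affineChart i (lineOf v) = RealProj.affineCoord i v := by
  rw [lineOf_of_ne_zero hv]
  exact RealProj.affineCoord_rep_mk i ⟨v, hv⟩

theorem affineChart_symm_apply (i : Fin 4) (y : EuclideanSpace ℝ (Fin 3)) :
    (RealProj.affineChart i).symm y = lineOf (RealProj.affineVec i y) :=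
  (lineOf_of_ne_zero (RealProj.affineVec_ne_zero i y)).symm

theorem lineOf_affineVec_affineChart {i : Fin 4} {x : RealProj 3}
    (hx : x ∈ (RealProj.affineChart i).source) :
    lineOf (RealProj.affineVec i (RealProj.affineChart i x)) = x := by
  rw [← affineChart_symm_apply, (RealProj.affineChart i).left_inv hx]

theorem affineChart_mem_maximalAtlas (i : Fin 4) :
    RealProj.affineChart i ∈ IsManifold.maximalAtlas (𝓡 3) ∞ (RealProj 3) :=
  IsManifold.subset_maximalAtlas ⟨i, rfl⟩

theorem exists_apply_ne_zero {v : R4} (hv : v ≠ 0) : ∃ i, v i ≠ 0 := by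
  by_contra! h
  exact hv (by ext i; simpa using h i)

theorem contMDiffAt_lineOf {v : R4} (hv : v ≠ 0) :
    ContMDiffAt 𝓘(ℝ, R4) (𝓡 3) ∞ lineOf v := by
  obtain ⟨i, hi⟩ := exists_apply_ne_zero hv
  have hopen : IsOpen {v : R4 | v i ≠ 0} := isOpen_ne_fun (by fun_prop) continuous_const
  have h1 : ContMDiffAt 𝓘(ℝ, R4) (𝓡 3) ∞ (RealProj.affineCoord i) v :=
    (((RealProj.contDiffOn_affineCoord i).of_le le_top).contDiffAt
      (hopen.mem_nhds hi)).contMDiffAt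
  have h2 : ContMDiffAt (𝓡 3) (𝓡 3) ∞ (RealProj.affineChart i).symm
      (RealProj.affineCoord i v) :=
    contMDiffAt_symm_of_mem_maximalAtlas (affineChart_mem_maximalAtlas i) (Set.mem_univ _)
  refine (h2.comp v h1).congr_of_eventuallyEq ?_
  filter_upwards [hopen.mem_nhds hi] with w hw
  have hw0 : w ≠ 0 := fun h => hw (by simp [h])
  rw [Function.comp_apply, affineChart_symm_apply]
  conv_lhs => rw [← RealProj.smul_affineVec_affineCoord i hw]
  exact lineOf_smul hw _

/-- The orthogonal projection to the line spanned by a vector. -/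
def projL (v : R4) : R4 →L[ℝ] R4 := (‖v‖ ^ 2)⁻¹ • (innerSL ℝ v).smulRight v

theorem projL_apply (v y : R4) : projL v y = ((‖v‖ ^ 2)⁻¹ * inner ℝ v y) • v := by
  simp [projL, smul_smul]

theorem projL_self {v : R4} (hv : v ≠ 0) : projL v v = v := by
  rw [projL_apply, real_inner_self_eq_norm_sq, inv_mul_cancel₀, one_smul]
  simpa using hv

theorem projL_smul {c : ℝ} (hc : c ≠ 0) (v : R4) : projL (c • v) = projL v := by
  by_cases hv : v = 0
  · simp [hv]
  have : ‖v‖ ≠ 0 := by simpa using hv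
  have hc' : |c| ^ 2 = c ^ 2 := sq_abs c
  ext1 y
  rw [projL_apply, projL_apply, norm_smul, real_inner_smul_left, smul_smul, Real.norm_eq_abs,
    mul_pow, hc']
  congr 1
  field_simp

theorem contDiffAt_projL {v : R4} (hv : v ≠ 0) : ContDiffAt ℝ ∞ projL v := by
  have h1 : ContDiffAt ℝ ∞ (fun v : R4 => (‖v‖ ^ 2)⁻¹) v :=
    (contDiff_norm_sq ℝ).contDiffAt.inv (by simpa using hv)
  have h2 : ContDiff ℝ ∞ (fun v : R4 => (innerSL ℝ v).smulRight v) :=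
    (innerSL ℝ).contDiff.smulRight contDiff_id
  exact h1.smul h2.contDiffAt

/-- The orthogonal projection to a line through the origin, as a function of the line. -/
def lineProj (x : RealProj 3) : R4 →L[ℝ] R4 := projL x.rep

theorem lineProj_lineOf {v : R4} (hv : v ≠ 0) : lineProj (lineOf v) = projL v := by
  obtain ⟨a, ha, h⟩ := exists_rep_lineOf hv
  rw [lineProj, h, projL_smul ha]

theorem lineProj_apply_self {v : R4} (hv : v ≠ 0) : lineProj (lineOf v) v = v := by
  rw [lineProj_lineOf hv, projL_self hv]

theorem lineOf_lineProj {x : RealProj 3} {y : R4} (h : lineProj x y ≠ 0) :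
    lineOf (lineProj x y) = x := by
  rw [lineProj, projL_apply] at h ⊢
  rw [lineOf_smul (smul_ne_zero_iff.1 h).1, lineOf_rep]

theorem contMDiff_lineProj : ContMDiff (𝓡 3) 𝓘(ℝ, R4 →L[ℝ] R4) ∞ lineProj := by
  intro x
  obtain ⟨i, hi⟩ := x.exists_rep_ne_zero
  have hx : x ∈ (RealProj.affineChart i).source := hi
  have h1 : ContMDiffAt (𝓡 3) (𝓡 3) ∞ (RealProj.affineChart i) x :=
    contMDiffAt_of_mem_maximalAtlas (affineChart_mem_maximalAtlas i) hx
  have h2 : ContMDiffAt (𝓡 3) 𝓘(ℝ, R4 →L[ℝ] R4) ∞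
      (fun y => projL (RealProj.affineVec i y)) (RealProj.affineChart i x) :=
    ((contDiffAt_projL (RealProj.affineVec_ne_zero i _)).comp _
      ((RealProj.contDiff_affineVec i).of_le le_top).contDiffAt).contMDiffAt
  refine (h2.comp x h1).congr_of_eventuallyEq ?_
  filter_upwards [(RealProj.affineChart i).open_source.mem_nhds hx] with y hy
  rw [Function.comp_apply, ← lineProj_lineOf (RealProj.affineVec_ne_zero i _),
    lineOf_affineVec_affineChart hy]

theorem contDiffAt_lineProj_comp {φ : RealProj 3 → RealProj 3} (hφ : ContMDiff (𝓡 3) (𝓡 3) ∞ φ)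
    {v : R4} (hv : v ≠ 0) : ContDiffAt ℝ ∞ (fun v => lineProj (φ (lineOf v))) v := by
  rw [← contMDiffAt_iff_contDiffAt]
  exact contMDiff_lineProj.contMDiffAt.comp v (hφ.contMDiffAt.comp v (contMDiffAt_lineOf hv))

/-- A smooth homogeneous lift of a diffeomorphism of `ℝP³` to `ℝ⁴` is a diffeomorphism of
`ℝ⁴ ∖ 0`. -/
theorem exists_isHomogeneousDiffeo_of_lift (φ : RealProj 3 ≃ₘ^∞⟮𝓡 3, 𝓡 3⟯ RealProj 3)
    {H : R4 → R4} (hH : ContDiffOn ℝ ∞ H {0}ᶜ) (hsmul : ∀ (c : ℝ) v, H (c • v) = c • H v)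
    (h0 : ∀ v, v ≠ 0 → H v ≠ 0) (hφ : ∀ v, v ≠ 0 → lineOf (H v) = φ (lineOf v)) :
    ∃ K, IsHomogeneousDiffeo H K := by
  have hH0 : H 0 = 0 := by simpa using hsmul 0 0
  have h0' : ∀ v, H v = 0 → v = 0 := fun v h => by_contra fun hv => h0 v hv h
  have hinj : Function.Injective H := by
    intro v w hvw
    by_cases hw : w = 0
    · rw [hw, hH0] at hvw
      rw [hw, h0' v hvw]
    · have hv : v ≠ 0 := fun hv => hw (h0' w (by rw [← hvw, hv, hH0]))
      have h1 : lineOf v = lineOf w := by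
        rw [← φ.symm_apply_apply (lineOf v), ← hφ v hv, hvw, hφ w hw, φ.symm_apply_apply]
      obtain ⟨a, rfl⟩ := (lineOf_eq_iff hv hw).1 h1
      have h2 : (a - 1) • H w = 0 := by rw [sub_smul, one_smul, ← hsmul, hvw, sub_self]
      have h3 : a = 1 := by
        rcases smul_eq_zero.1 h2 with h | h
        · linarith
        · exact absurd h (h0 w hw)
      rw [h3, one_smul]
  have hsurj : Function.Surjective H := by
    intro y
    by_cases hy : y = 0
    · exact ⟨0, by rw [hy, hH0]⟩
    let r := (φ.symm (lineOf y)).rep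
    have hr : r ≠ 0 := RealProj.rep_ne_zero _
    have h1 : lineOf y = lineOf (H r) := by
      rw [hφ r hr, lineOf_rep, φ.apply_symm_apply]
    obtain ⟨a, ha⟩ := (lineOf_eq_iff hy (h0 r hr)).1 h1
    exact ⟨a • r, by rw [hsmul, ha]⟩
  let e := Equiv.ofBijective H ⟨hinj, hsurj⟩
  have hl : ∀ v, e.symm (H v) = v := fun v => e.symm_apply_apply v
  have hr : ∀ v, H (e.symm v) = v := fun v => e.apply_symm_apply v
  refine ⟨e.symm, hH, ?_, hsmul, ?_, hl, hr⟩
  · intro y₀ hy₀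
    have hy₀' : y₀ ≠ 0 := hy₀
    apply ContDiffAt.contDiffWithinAt
    set r₀ := e.symm y₀ with hr₀
    have hr₀0 : r₀ ≠ 0 := fun h => hy₀' (by rw [← hr y₀, ← hr₀, h, hH0])
    let a : R4 → R4 := fun y => lineProj (φ.symm (lineOf y)) r₀
    have ha : ContDiffAt ℝ ∞ a y₀ :=
      (contDiffAt_lineProj_comp φ.symm.contMDiff hy₀').clm_apply contDiffAt_const
    have ha0 : a y₀ = r₀ := by
      have h1 : φ.symm (lineOf y₀) = lineOf r₀ := by
        rw [← hr y₀, hφ _ hr₀0, φ.symm_apply_apply]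
      simp only [a]
      rw [h1, lineProj_apply_self hr₀0]
    let μ : R4 → ℝ := fun y => (‖y‖ ^ 2)⁻¹ * inner ℝ y (H (a y))
    have hHa : ContDiffAt ℝ ∞ (fun y => H (a y)) y₀ := by
      refine ContDiffAt.comp y₀ ?_ ha
      rw [ha0]
      exact hH.contDiffAt (isOpen_compl_singleton.mem_nhds hr₀0)
    have hμ : ContDiffAt ℝ ∞ μ y₀ :=
      ((contDiff_norm_sq ℝ).contDiffAt.inv (by simpa using hy₀')).mul
        (contDiffAt_id.inner ℝ hHa)
    have hμ0 : μ y₀ = 1 := by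
      simp only [μ]
      rw [ha0, hr, real_inner_self_eq_norm_sq, inv_mul_cancel₀]
      simpa using hy₀'
    have hμ0' : μ y₀ ≠ 0 := by rw [hμ0]; exact one_ne_zero
    refine ((hμ.inv hμ0').smul ha).congr_of_eventuallyEq ?_
    have hane : a y₀ ≠ 0 := by rw [ha0]; exact hr₀0
    filter_upwards [ha.continuousAt.eventually_ne hane, hμ.continuousAt.eventually_ne hμ0',
      isOpen_compl_singleton.mem_nhds hy₀'] with y hay hμy hy
    have hy' : y ≠ 0 := hy
    apply hinj
    change H (e.symm y) = H ((μ y)⁻¹ • a y)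
    rw [hr, hsmul]
    have h1 : lineOf (H (a y)) = lineOf y := by
      rw [hφ _ hay, lineOf_lineProj hay, φ.apply_symm_apply]
    obtain ⟨b, hb⟩ := (lineOf_eq_iff (h0 _ hay) hy').1 h1
    have h2 : μ y = b := by
      simp only [μ]
      rw [← hb, real_inner_smul_right, real_inner_self_eq_norm_sq]
      have : ‖y‖ ≠ 0 := by simpa using hy'
      field_simp
    rw [← hb, h2, smul_smul, inv_mul_cancel₀ (h2 ▸ hμy), one_smul]
  · intro c v
    apply hinj
    rw [hr, hsmul, hr]

/-- A diffeomorphism of `ℝP³` isotopic to the identity lifts to a homogeneous diffeomorphism of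
`ℝ⁴ ∖ 0`. The lift is obtained in finitely many steps along the isotopy: when two lines
are not orthogonal, a vector on the first is moved to the second by orthogonal projection. -/
theorem exists_homogeneous_lift (φ : ℝ → (RealProj 3 ≃ₘ^∞⟮𝓡 3, 𝓡 3⟯ RealProj 3))
    (hφ : ContMDiffOn (𝓘(ℝ, ℝ).prod (𝓡 3)) (𝓡 3) ∞ (fun y : ℝ × RealProj 3 => φ y.1 y.2)
      (Set.Icc 0 1 ×ˢ Set.univ)) (hφ0 : ∀ x, φ 0 x = x) :
    ∃ H K, IsHomogeneousDiffeo H K ∧ ∀ v, v ≠ 0 → lineOf (H v) = φ 1 (lineOf v) := by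
  let J : ℝ × R4 → (R4 →L[ℝ] R4) := fun z => lineProj (φ z.1 (lineOf z.2))
  have hlc : ContinuousOn lineOf {0}ᶜ := fun v hv =>
    (contMDiffAt_lineOf hv).continuousAt.continuousWithinAt
  have hJ : ContinuousOn J (Set.Icc 0 1 ×ˢ Metric.sphere 0 1) := by
    refine contMDiff_lineProj.continuous.comp_continuousOn ?_
    refine hφ.continuousOn.comp (f := fun z : ℝ × R4 => (z.1, lineOf z.2))
      (continuousOn_fst.prodMk (hlc.comp continuousOn_snd ?_)) ?_
    · intro z hz
      exact ne_zero_of_mem_unit_sphere ⟨z.2, hz.2⟩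
    · intro z hz
      exact ⟨hz.1, Set.mem_univ _⟩
  have hJu := (isCompact_Icc.prod (isCompact_sphere (0 : R4) 1)).uniformContinuousOn_of_continuous hJ
  obtain ⟨δ, hδ, hJδ⟩ := Metric.uniformContinuousOn_iff.1 hJu 1 one_pos
  obtain ⟨N, hN⟩ := exists_nat_one_div_lt hδ
  let t : ℕ → ℝ := fun i => i / (N + 1)
  have hN1 : (0 : ℝ) < N + 1 := by positivity
  have ht : ∀ i ≤ N + 1, t i ∈ Set.Icc (0 : ℝ) 1 := fun i hi => by
    refine ⟨by positivity, (div_le_one hN1).2 (by exact_mod_cast hi)⟩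
  have hclose : ∀ i ≤ N, ∀ v, v ≠ 0 →
      ‖lineProj (φ (t i) (lineOf v)) - lineProj (φ (t (i + 1)) (lineOf v))‖ < 1 := by
    intro i hi v hv
    have hvn : ‖v‖ ≠ 0 := by simpa using hv
    have hs : ‖v‖⁻¹ • v ∈ Metric.sphere (0 : R4) 1 := by
      simp [norm_smul, inv_mul_cancel₀ hvn]
    have := hJδ (t i, ‖v‖⁻¹ • v) ⟨ht i (by omega), hs⟩ (t (i + 1), ‖v‖⁻¹ • v)
      ⟨ht (i + 1) (by omega), hs⟩ (by
        rw [Prod.dist_eq, dist_self, max_eq_left dist_nonneg, Real.dist_eq]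
        have e : t i - t (i + 1) = -(1 / (N + 1)) := by
          simp only [t]; push_cast; field_simp; ring
        rw [e, abs_neg, abs_of_pos (by positivity)]
        exact hN)
    simp only [J, lineOf_smul (inv_ne_zero hvn), dist_eq_norm] at this
    exact this
  have main : ∀ i ≤ N + 1, ∃ H : R4 → R4, ContDiffOn ℝ ∞ H {0}ᶜ ∧
      (∀ (c : ℝ) v, H (c • v) = c • H v) ∧ (∀ v, v ≠ 0 → H v ≠ 0) ∧
      ∀ v, v ≠ 0 → lineOf (H v) = φ (t i) (lineOf v) := by
    intro i
    induction i with
    | zero =>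
      intro _
      exact ⟨id, contDiffOn_id, fun c v => rfl, fun v hv => hv, fun v _ => by simp [t, hφ0]⟩
    | succ i ih =>
      intro hi
      obtain ⟨H, hH, hsm, hne, hl⟩ := ih (by omega)
      have hH0 : H 0 = 0 := by simpa using hsm 0 0
      have hne' : ∀ v, v ≠ 0 → lineProj (φ (t (i + 1)) (lineOf v)) (H v) ≠ 0 := by
        intro v hv h
        have h1 : lineProj (φ (t i) (lineOf v)) (H v) = H v := by
          rw [← hl v hv, lineProj_apply_self (hne v hv)]
        have h2 := (lineProj (φ (t i) (lineOf v)) -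
          lineProj (φ (t (i + 1)) (lineOf v))).le_opNorm (H v)
        rw [sub_apply, h, h1, sub_zero] at h2
        have h3 : 0 < ‖H v‖ := norm_pos_iff.2 (hne v hv)
        nlinarith [hclose i (by omega) v hv]
      refine ⟨fun v => lineProj (φ (t (i + 1)) (lineOf v)) (H v), ?_, ?_, hne', ?_⟩
      · intro v hv
        exact (contDiffAt_lineProj_comp (φ (t (i + 1))).contMDiff hv).contDiffWithinAt.clm_apply
          (hH v hv)
      · intro c v
        by_cases hc : c = 0
        · simp [hc, hH0]
        · simp only [lineOf_smul hc, hsm, map_smul]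
      · intro v hv
        exact lineOf_lineProj (hne' v hv)
  obtain ⟨H, hH, hsm, hne, hl⟩ := main (N + 1) le_rfl
  have ht1 : t (N + 1) = 1 := by
    simp only [t]; push_cast; exact div_self hN1.ne'
  rw [ht1] at hl
  obtain ⟨K, hK⟩ := exists_isHomogeneousDiffeo_of_lift (φ 1) hH hsm hne hl
  exact ⟨H, K, hK, hl⟩

/-! ### Torus links in terms of angles -/

theorem conjPow_exp (x : ℝ) (p : ℤ) :
    conjPow (Complex.exp (x * Complex.I)) p = Complex.exp ((p * x : ℝ) * Complex.I) := by
  rw [conjPow]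
  split_ifs with h
  · obtain ⟨n, rfl⟩ := Int.eq_ofNat_of_zero_le h
    rw [Int.natAbs_natCast, ← Complex.exp_nat_mul]
    push_cast
    ring_nf
  · obtain ⟨n, hn⟩ := Int.eq_ofNat_of_zero_le (by omega : 0 ≤ -p)
    obtain rfl : p = -(n : ℤ) := by omega
    rw [Int.natAbs_neg, Int.natAbs_natCast, ← Complex.exp_conj, ← Complex.exp_nat_mul]
    congr 1
    simp [mul_assoc]

theorem norm_conjPow (z : ℂ) (p : ℤ) : ‖conjPow z p‖ = ‖z‖ ^ p.natAbs := by
  rw [conjPow]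
  split_ifs <;> simp

theorem onLink_iff_conjPow {p q : ℤ} {P : ℝ × ℝ} :
    OnLink p q P ↔ conjPow (zCoord (torusPt P)) p = conjPow (wCoord (torusPt P)) q := by
  rw [zCoord_torusPt, wCoord_torusPt, conjPow_exp, conjPow_exp, Complex.exp_eq_exp_iff_exists_int]
  refine exists_congr fun k => ?_
  constructor
  · intro h
    have : (p * P.1 : ℝ) = q * P.2 + k * (2 * Real.pi) := by linarith
    rw [this]
    push_cast
    ring
  · intro h
    have := congrArg Complex.im h
    simp at this
    linarith

theorem torusPt_mem_torusLink {p q : ℤ} {P : ℝ × ℝ} (h : OnLink p q P) :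
    torusPt P ∈ torusLink p q := by
  refine ⟨?_, onLink_iff_conjPow.1 h⟩
  change ‖zCoord (torusPt P)‖ ^ 2 + ‖wCoord (torusPt P)‖ ^ 2 = 2
  rw [zCoord_torusPt, wCoord_torusPt, Complex.norm_exp_ofReal_mul_I, Complex.norm_exp_ofReal_mul_I]
  norm_num

theorem exists_eq_torusPt {p q : ℤ} (h0 : ¬(p = 0 ∧ q = 0)) {v : R4} (hv : v ∈ torusLink p q) :
    ∃ P, OnLink p q P ∧ v = torusPt P := by
  obtain ⟨h1, h2⟩ := hv
  change ‖zCoord v‖ ^ 2 + ‖wCoord v‖ ^ 2 = 2 at h1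
  change conjPow (zCoord v) p = conjPow (wCoord v) q at h2
  have h3 : ‖zCoord v‖ ^ p.natAbs = ‖wCoord v‖ ^ q.natAbs := by
    rw [← norm_conjPow, ← norm_conjPow, h2]
  have hz := norm_nonneg (zCoord v)
  have hw := norm_nonneg (wCoord v)
  have hz1 : ‖zCoord v‖ = 1 := by
    by_cases hp : p = 0
    · have hq : q.natAbs ≠ 0 := fun hq => h0 ⟨hp, Int.natAbs_eq_zero.1 hq⟩
      subst hp
      have : ‖wCoord v‖ = 1 := (pow_eq_one_iff_of_nonneg hw hq).1 (by simpa using h3.symm)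
      rw [this] at h1
      nlinarith
    · have hp' : p.natAbs ≠ 0 := fun hp' => hp (Int.natAbs_eq_zero.1 hp')
      rcases lt_trichotomy ‖zCoord v‖ 1 with h | h | h
      · have h4 : ‖zCoord v‖ ^ p.natAbs < 1 := pow_lt_one₀ hz h hp'
        have h5 : 1 ≤ ‖wCoord v‖ := by nlinarith
        have h6 : 1 ≤ ‖wCoord v‖ ^ q.natAbs := one_le_pow₀ h5
        linarith
      · exact h
      · have h4 : 1 < ‖zCoord v‖ ^ p.natAbs := one_lt_pow₀ h hp'
        have h5 : ‖wCoord v‖ ≤ 1 := by nlinarith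
        have h6 : ‖wCoord v‖ ^ q.natAbs ≤ 1 := pow_le_one₀ hw h5
        linarith
  have hw1 : ‖wCoord v‖ = 1 := by
    rw [hz1] at h1
    nlinarith
  have h4 := smul_torusPt_arg (hz1.trans hw1.symm)
  rw [hz1, one_smul] at h4
  refine ⟨_, onLink_iff_conjPow.2 ?_, h4.symm⟩
  rw [h4, h2]

theorem mem_projTorusLink_iff {p q : ℤ} (h0 : ¬(p = 0 ∧ q = 0)) {x : RealProj 3} :
    x ∈ projTorusLink p q ↔ ∃ P, OnLink p q P ∧ lineOf (torusPt P) = x := by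
  constructor
  · rintro ⟨v, hv, rfl⟩
    obtain ⟨P, hP, h⟩ := exists_eq_torusPt h0 hv
    exact ⟨P, hP, by rw [← h, lineOf_of_ne_zero v.2]⟩
  · rintro ⟨P, hP, rfl⟩
    exact ⟨⟨torusPt P, torusPt_ne_zero P⟩, torusPt_mem_torusLink hP,
      (lineOf_of_ne_zero (torusPt_ne_zero P)).symm⟩

theorem antipodalEq_of_lineOf_eq {P P' : ℝ × ℝ} (h : lineOf (torusPt P) = lineOf (torusPt P')) :
    AntipodalEq P P' := by
  obtain ⟨a, ha⟩ := (lineOf_eq_iff (torusPt_ne_zero P) (torusPt_ne_zero P')).1 h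
  apply AntipodalEq.symm
  apply antipodalEq_of_torusPt_eq
  have h0 : a * Real.cos P'.1 = Real.cos P.1 := congrArg (fun v : R4 => v 0) ha
  have h1 : a * Real.sin P'.1 = Real.sin P.1 := congrArg (fun v : R4 => v 1) ha
  have h2 : a * a = 1 := by
    have t := Real.sin_sq_add_cos_sq P.1
    rw [← h0, ← h1] at t
    have t' := Real.sin_sq_add_cos_sq P'.1
    nlinarith
  rcases mul_self_eq_one_iff.1 h2 with h | h
  · left; rw [← ha, h, one_smul]
  · right; rw [← ha, h, neg_one_smul]

theorem AntipodalEq.lineOf_eq {P P' : ℝ × ℝ} (h : AntipodalEq P P') :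
    lineOf (torusPt P') = lineOf (torusPt P) := by
  rcases h.torusPt_eq with h | h
  · rw [h]
  · rw [h, ← neg_one_smul ℝ, lineOf_smul (by norm_num)]

/-! ### Planes and tangent vectors -/

/-- The projective plane orthogonal to a vector. -/
def planeOf (u : R4) : Set (RealProj 3) := {x | inner ℝ u x.rep = (0 : ℝ)}

theorem lineOf_mem_planeOf {u v : R4} (hv : v ≠ 0) :
    lineOf v ∈ planeOf u ↔ inner ℝ u v = (0 : ℝ) := by
  obtain ⟨a, ha, h⟩ := exists_rep_lineOf hv
  simp [planeOf, h, real_inner_smul_right, ha]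

theorem isProjPlane_planeOf {u : R4} (hu : u ≠ 0) : IsProjPlane (planeOf u) := by
  refine ⟨(ℝ ∙ u)ᗮ, ?_, ?_⟩
  · have h := (ℝ ∙ u).finrank_add_finrank_orthogonal
    rw [finrank_span_singleton hu, finrank_euclideanSpace_fin] at h
    exact Nat.add_left_cancel (h.trans (by norm_num : 4 = 1 + 3))
  · ext x
    exact (Submodule.mem_orthogonal_singleton_iff_inner_right).symm

theorem exists_eq_planeOf {P : Set (RealProj 3)} (hP : IsProjPlane P) :
    ∃ u, u ≠ 0 ∧ P = planeOf u := by
  obtain ⟨W, hW, rfl⟩ := hP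
  have h := W.finrank_add_finrank_orthogonal
  rw [hW, finrank_euclideanSpace_fin] at h
  have h1 : Module.finrank ℝ Wᗮ = 1 := by omega
  obtain ⟨u, hu, hspan⟩ := finrank_eq_one_iff'.1 h1
  have hu0 : (u : R4) ≠ 0 := fun h => hu (Subtype.ext h)
  refine ⟨u, hu0, ?_⟩
  ext x
  simp only [planeOf]
  constructor
  · intro hx
    exact Submodule.inner_left_of_mem_orthogonal hx u.2
  · intro hx
    have : x.rep ∈ Wᗮᗮ := by
      rw [Submodule.mem_orthogonal]
      intro v hv
      obtain ⟨c, hc⟩ := hspan ⟨v, hv⟩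
      have hc' : c • (u : R4) = v := congrArg Subtype.val hc
      rw [← hc', real_inner_smul_left]
      have hx' : inner ℝ (u : R4) x.rep = (0 : ℝ) := hx
      rw [hx', mul_zero]
    rwa [Submodule.orthogonal_orthogonal] at this

/-- The normal vector of the plane orthogonal to `u` in an affine chart. -/
def affineNormal (i : Fin 4) (u : R4) : EuclideanSpace ℝ (Fin 3) :=
  WithLp.toLp 2 fun j => u (i.succAbove j)

theorem inner_affineVec (i : Fin 4) (u : R4) (y : EuclideanSpace ℝ (Fin 3)) :
    inner ℝ u (RealProj.affineVec i y) = u i + inner ℝ (affineNormal i u) y := by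
  rw [PiLp.inner_apply, PiLp.inner_apply, Fin.sum_univ_succAbove _ i]
  simp [affineNormal]

theorem exists_chartAt_eq (x : RealProj 3) :
    ∃ i, chartAt (EuclideanSpace ℝ (Fin 3)) x = RealProj.affineChart i ∧
      x ∈ (RealProj.affineChart i).source := by
  obtain ⟨i, hi⟩ := chart_mem_atlas (EuclideanSpace ℝ (Fin 3)) x
  exact ⟨i, hi.symm, hi ▸ mem_chart_source _ x⟩

theorem exists_hasDerivAt_affineChart {γ : ℝ → RealProj 3}
    (hγ : ContMDiff 𝓘(ℝ, ℝ) (𝓡 3) ∞ γ) {i : Fin 4}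
    (hi : chartAt (EuclideanSpace ℝ (Fin 3)) (γ 0) = RealProj.affineChart i) :
    ∃ d : EuclideanSpace ℝ (Fin 3), HasDerivAt (fun t => RealProj.affineChart i (γ t)) d 0 ∧
      mfderiv 𝓘(ℝ, ℝ) (𝓡 3) γ 0 (1 : ℝ) = d := by
  let D : ℝ →L[ℝ] EuclideanSpace ℝ (Fin 3) := mfderiv 𝓘(ℝ, ℝ) (𝓡 3) γ 0
  have h : HasFDerivWithinAt (writtenInExtChartAt 𝓘(ℝ, ℝ) (𝓡 3) 0 γ) D
      (Set.range 𝓘(ℝ, ℝ)) (extChartAt 𝓘(ℝ, ℝ) (0 : ℝ) 0) :=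
    ((hγ 0).mdifferentiableAt (by simp)).hasMFDerivAt.2
  have e : writtenInExtChartAt 𝓘(ℝ, ℝ) (𝓡 3) 0 γ = fun t => RealProj.affineChart i (γ t) := by
    ext1 t
    simp [writtenInExtChartAt, extChartAt, hi]
    rfl
  rw [e] at h
  have h' : HasFDerivAt (fun t => RealProj.affineChart i (γ t)) D 0 := by
    rw [modelWithCornersSelf_coe, Set.range_id] at h
    exact hasFDerivWithinAt_univ.1 h
  exact ⟨D 1, h'.hasDerivAt, rfl⟩

theorem HasDerivAt.inner_const_left {E : Type*} [NormedAddCommGroup E] [InnerProductSpace ℝ E]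
    {f : ℝ → E} {d : E} {t : ℝ} (n : E) (h : HasDerivAt f d t) :
    HasDerivAt (fun t => (inner ℝ n (f t) : ℝ)) (inner ℝ n d) t :=
  ((innerSL ℝ n).hasFDerivAt).comp_hasDerivAt t h

theorem mem_planeOf_iff {i : Fin 4} {x : RealProj 3} (hx : x ∈ (RealProj.affineChart i).source)
    (u : R4) :
    x ∈ planeOf u ↔ inner ℝ u (RealProj.affineVec i (RealProj.affineChart i x)) = (0 : ℝ) := by
  rw [← lineOf_mem_planeOf (RealProj.affineVec_ne_zero i _), lineOf_affineVec_affineChart hx]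

/-- A submanifold transverse to a plane has a curve crossing the plane with nonzero speed. -/
theorem exists_curve_of_areTransverse {S : Set (RealProj 3)} {u : R4} (hu : u ≠ 0)
    (h : AreTransverse S (planeOf u)) {x : RealProj 3} (hxS : x ∈ S) (hxP : x ∈ planeOf u) :
    ∃ γ : ℝ → RealProj 3, ContMDiff 𝓘(ℝ, ℝ) (𝓡 3) ∞ γ ∧ (∀ t, γ t ∈ S) ∧ γ 0 = x ∧
      ∃ (i : Fin 4) (d : EuclideanSpace ℝ (Fin 3)), x ∈ (RealProj.affineChart i).source ∧
        HasDerivAt (fun t => RealProj.affineChart i (γ t)) d 0 ∧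
        inner ℝ (affineNormal i u) d ≠ (0 : ℝ) := by
  obtain ⟨i, hi, hxi⟩ := exists_chartAt_eq x
  by_contra! hno
  let ℓ : EuclideanSpace ℝ (Fin 3) →ₗ[ℝ] ℝ := innerₗ _ (affineNormal i u)
  let k : Submodule ℝ (TangentSpace (𝓡 3) x) := LinearMap.ker ℓ
  have h1 : tangentSpaceOf S x ≤ k := by
    refine Submodule.span_le.2 ?_
    rintro _ ⟨γ, hγ, hγS, rfl, rfl⟩
    obtain ⟨d, hd, hdd⟩ := exists_hasDerivAt_affineChart hγ hi
    change ℓ (mfderiv 𝓘(ℝ, ℝ) (𝓡 3) γ 0 (1 : ℝ)) = 0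
    rw [hdd]
    exact hno γ hγ hγS rfl i d hxi hd
  have h2 : tangentSpaceOf (planeOf u) x ≤ k := by
    refine Submodule.span_le.2 ?_
    rintro _ ⟨γ, hγ, hγS, rfl, rfl⟩
    obtain ⟨d, h3, hdd⟩ := exists_hasDerivAt_affineChart hγ hi
    change ℓ (mfderiv 𝓘(ℝ, ℝ) (𝓡 3) γ 0 (1 : ℝ)) = 0
    rw [hdd]
    have h4 := HasDerivAt.inner_const_left (affineNormal i u) h3
    have h5 : (fun t => (inner ℝ (affineNormal i u) (RealProj.affineChart i (γ t)) : ℝ))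
        =ᶠ[nhds 0] fun _ => -u i := by
      have hnear : ∀ᶠ t in nhds (0 : ℝ), γ t ∈ (RealProj.affineChart i).source :=
        hγ.continuous.continuousAt.eventually_mem
          ((RealProj.affineChart i).open_source.mem_nhds hxi)
      filter_upwards [hnear] with t ht
      have := (mem_planeOf_iff ht u).1 (hγS t)
      rw [inner_affineVec] at this
      linarith
    exact h4.unique ((hasDerivAt_const (0 : ℝ) (-u i)).congr_of_eventuallyEq h5)
  have h3 : k = ⊤ := top_le_iff.1 (h x ⟨hxS, hxP⟩ ▸ sup_le h1 h2)
  have h4 : affineNormal i u = 0 := by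
    have h5 : ∀ w : TangentSpace (𝓡 3) x, w ∈ k := fun w => h3 ▸ Submodule.mem_top
    have h6 : inner ℝ (affineNormal i u) (affineNormal i u) = (0 : ℝ) := h5 (affineNormal i u)
    exact inner_self_eq_zero.1 h6
  have h5 := (mem_planeOf_iff hxi u).1 hxP
  rw [inner_affineVec, h4, inner_zero_left, add_zero] at h5
  refine hu ?_
  ext j
  rcases Fin.eq_self_or_eq_succAbove i j with rfl | ⟨j, rfl⟩
  · exact h5
  · exact congrArg (fun v : EuclideanSpace ℝ (Fin 3) => v j) h4

/-- A submanifold that has, at each intersection point with a plane, a curve crossing the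
plane with nonzero speed, is transverse to the plane. -/
theorem areTransverse_planeOf {S : Set (RealProj 3)} {u : R4}
    (h : ∀ x ∈ S ∩ planeOf u, ∃ c : ℝ → R4, ContDiff ℝ ∞ c ∧ (∀ t, c t ≠ 0) ∧
      (∀ t, lineOf (c t) ∈ S) ∧ lineOf (c 0) = x ∧ deriv (fun t => inner ℝ u (c t)) 0 ≠ (0 : ℝ)) :
    AreTransverse S (planeOf u) := by
  rintro x ⟨hxS, hxP⟩
  obtain ⟨c, hc, hc0, hcS, rfl, hd⟩ := h x ⟨hxS, hxP⟩
  obtain ⟨i, hi, hxi⟩ := exists_chartAt_eq (lineOf (c 0))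
  let γ : ℝ → RealProj 3 := fun t => lineOf (c t)
  have hγ : ContMDiff 𝓘(ℝ, ℝ) (𝓡 3) ∞ γ := fun t =>
    (contMDiffAt_lineOf (hc0 t)).comp t hc.contMDiff.contMDiffAt
  obtain ⟨d, hγd, hdd⟩ := exists_hasDerivAt_affineChart hγ hi
  let n := affineNormal i u
  have hmem : ∀ t, γ t ∈ (RealProj.affineChart i).source ↔ c t i ≠ 0 := fun t => by
    simp only [γ, lineOf_of_ne_zero (hc0 t)]
    exact RealProj.rep_mk_apply_ne_zero i ⟨c t, hc0 t⟩
  have hn : inner ℝ n d ≠ (0 : ℝ) := by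
    intro hnd
    have h4 : HasDerivAt (fun t => (inner ℝ n (RealProj.affineChart i (γ t)) : ℝ)) 0 0 := by
      have := HasDerivAt.inner_const_left n hγd
      rwa [hnd] at this
    have hci : HasDerivAt (fun t => c t i) (deriv (fun t => c t i) 0) 0 :=
      ((contDiff_euclidean.1 hc i).differentiable (by simp) 0).hasDerivAt
    have hprod := hci.mul (h4.const_add (u i))
    have h5 : (u i + inner ℝ n (RealProj.affineChart i (γ 0)) : ℝ) = 0 := by
      rw [← inner_affineVec]
      exact (mem_planeOf_iff hxi u).1 hxP
    rw [h5, mul_zero, mul_zero, add_zero] at hprod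
    have h6 : (fun t => (inner ℝ u (c t) : ℝ)) =ᶠ[nhds 0]
        (fun t => c t i) * fun t => u i + inner ℝ n (RealProj.affineChart i (γ t)) := by
      have hnear : ∀ᶠ t in nhds (0 : ℝ), c t i ≠ 0 :=
        hci.continuousAt.eventually_ne ((hmem 0).1 hxi)
      filter_upwards [hnear] with t ht
      rw [Pi.mul_apply, ← inner_affineVec, ← real_inner_smul_right, affineChart_lineOf i (hc0 t),
        RealProj.smul_affineVec_affineCoord i ht]
    exact hd (hprod.congr_of_eventuallyEq h6).deriv
  have hdS : (d : TangentSpace (𝓡 3) (lineOf (c 0))) ∈ tangentSpaceOf S (lineOf (c 0)) :=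
    Submodule.subset_span ⟨γ, hγ, hcS, rfl, hdd.symm⟩
  have hker : ∀ w : EuclideanSpace ℝ (Fin 3), inner ℝ n w = (0 : ℝ) →
      (w : TangentSpace (𝓡 3) (lineOf (c 0))) ∈ tangentSpaceOf (planeOf u) (lineOf (c 0)) := by
    intro w hw
    let y := RealProj.affineChart i (lineOf (c 0))
    let b : ℝ → R4 := fun t => RealProj.affineVec i (y + t • w)
    have hb : ContDiff ℝ ∞ b :=
      ((RealProj.contDiff_affineVec i).of_le le_top).comp (by fun_prop)
    let β : ℝ → RealProj 3 := fun t => lineOf (b t)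
    have hβ : ContMDiff 𝓘(ℝ, ℝ) (𝓡 3) ∞ β := fun t =>
      (contMDiffAt_lineOf (RealProj.affineVec_ne_zero i _)).comp t hb.contMDiff.contMDiffAt
    have hβ0 : β 0 = lineOf (c 0) := by
      simp only [β, b, zero_smul, add_zero]
      exact lineOf_affineVec_affineChart hxi
    have hβP : ∀ t, β t ∈ planeOf u := fun t => by
      rw [lineOf_mem_planeOf (RealProj.affineVec_ne_zero i _), inner_affineVec, inner_add_right,
        real_inner_smul_right, hw, mul_zero, add_zero, ← inner_affineVec]
      exact (mem_planeOf_iff hxi u).1 hxP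
    obtain ⟨d', hβd, hdd'⟩ := exists_hasDerivAt_affineChart hβ (hβ0 ▸ hi)
    have e : (fun t => RealProj.affineChart i (β t)) = fun t => y + t • w := funext fun t => by
      simp only [β, b]
      rw [affineChart_lineOf i (RealProj.affineVec_ne_zero i _), RealProj.affineCoord_affineVec]
    rw [e] at hβd
    have hβd' : HasDerivAt (fun t : ℝ => y + t • w) w 0 := by
      simpa using ((hasDerivAt_id (0 : ℝ)).smul_const w).const_add y
    refine Submodule.subset_span ⟨β, hβ, hβP, hβ0, ?_⟩
    have e2 : ∀ (x : RealProj 3) (h : β 0 = x),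
        (h ▸ mfderiv 𝓘(ℝ, ℝ) (𝓡 3) β 0 (1 : ℝ) : TangentSpace (𝓡 3) x) =
          (mfderiv 𝓘(ℝ, ℝ) (𝓡 3) β 0 (1 : ℝ) : EuclideanSpace ℝ (Fin 3)) := by
      rintro x rfl; rfl
    rw [e2, hdd']
    exact hβd'.unique hβd
  rw [eq_top_iff]
  rintro w -
  let w' : EuclideanSpace ℝ (Fin 3) := w
  let a : ℝ := inner ℝ n w' / inner ℝ n d
  have h7 : inner ℝ n (w' - a • d) = (0 : ℝ) := by
    rw [inner_sub_right, real_inner_smul_right, div_mul_cancel₀ _ hn, sub_self]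
  have h8 : a • d + (w' - a • d) = w' := by abel
  exact Eq.subst (motive := fun y : TangentSpace (𝓡 3) (lineOf (c 0)) =>
      y ∈ tangentSpaceOf S (lineOf (c 0)) ⊔ tangentSpaceOf (planeOf u) (lineOf (c 0))) h8
    (Submodule.add_mem_sup (Submodule.smul_mem _ a hdS) (hker _ h7))

/-! ### The lower bound -/

theorem differentiable_zCoord : Differentiable ℝ zCoord := by
  have : zCoord = fun v => Complex.ofRealCLM (v 0) + Complex.ofRealCLM (v 1) * Complex.I := by
    ext v; apply Complex.ext <;> simp [zCoord]
  rw [this]; fun_prop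

theorem differentiable_wCoord : Differentiable ℝ wCoord := by
  have : wCoord = fun v => Complex.ofRealCLM (v 2) + Complex.ofRealCLM (v 3) * Complex.I := by
    ext v; apply Complex.ext <;> simp [wCoord]
  rw [this]; fun_prop

theorem zCoord_smul (c : ℝ) (v : R4) : zCoord (c • v) = c * zCoord v := by
  apply Complex.ext <;> simp [zCoord]

theorem wCoord_smul (c : ℝ) (v : R4) : wCoord (c • v) = c * wCoord v := by
  apply Complex.ext <;> simp [wCoord]

theorem ext_coord {v w : R4} (hz : zCoord v = zCoord w) (hw : wCoord v = wCoord w) : v = w :=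
  ext_R4 (congrArg Complex.re hz) (congrArg Complex.im hz) (congrArg Complex.re hw)
    (congrArg Complex.im hw)

theorem differentiableAt_arg {f : ℝ → ℂ} {t : ℝ} (hf : DifferentiableAt ℝ f t)
    (h : f t ∈ Complex.slitPlane) : DifferentiableAt ℝ (fun t => (f t).arg) t := by
  have h1 : DifferentiableAt ℝ (fun t => Complex.log (f t)) t :=
    (hf.hasDerivAt.clog_real h).differentiableAt
  exact (Complex.imCLM.differentiableAt.comp t h1).congr_of_eventuallyEq
    (Filter.Eventually.of_forall fun s => (Complex.log_im (f s)).symm)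

/-- If a plane is transverse to the image of a torus link, then the height function has simple
zeros along the link. A smooth curve in the image that crosses the plane with nonzero speed is
pulled back to the angle coordinates, where it runs along the line of direction `(q, p)`. -/
theorem IsHomogeneousDiffeo.fderiv_heightFn_ne_zero {H K : R4 → R4}
    (hHK : IsHomogeneousDiffeo H K) (φ : RealProj 3 ≃ₘ^∞⟮𝓡 3, 𝓡 3⟯ RealProj 3)
    (hφ : ∀ v, v ≠ 0 → lineOf (H v) = φ (lineOf v)) {p q : ℤ} (hq : q ≠ 0)
    (hpq : p ≡ q [ZMOD 2]) {u : R4} (hu : u ≠ 0)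
    (htr : AreTransverse (φ '' projTorusLink p q) (planeOf u)) {P : ℝ × ℝ} (hP : OnLink p q P)
    (hP0 : heightFn H u P = 0) : fderiv ℝ (heightFn H u) P ((q : ℝ), (p : ℝ)) ≠ 0 := by
  intro hder
  have h0 : ¬(p = 0 ∧ q = 0) := fun h => hq h.2
  have hqR : (q : ℝ) ≠ 0 := by exact_mod_cast hq
  have hPne := torusPt_ne_zero P
  have hKφ : ∀ y, y ≠ 0 → lineOf (K y) = φ.symm (lineOf y) := fun y hy => by
    rw [← φ.symm_apply_apply (lineOf (K y)), ← hφ _ (hHK.inv_map_ne_zero hy), hHK.right_inv]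
  obtain ⟨γ, hγ, hγS, hγ0, i, d, hxi, hd, hdn⟩ := exists_curve_of_areTransverse hu htr
    (x := φ (lineOf (torusPt P))) ⟨_, (mem_projTorusLink_iff h0).2 ⟨P, hP, rfl⟩, rfl⟩
    (by rw [← hφ _ hPne]; exact (lineOf_mem_planeOf (hHK.map_ne_zero hPne)).2 hP0)
  let η : ℝ → R4 := fun t => RealProj.affineVec i (RealProj.affineChart i (γ t))
  have hη0 : ∀ t, η t ≠ 0 := fun t => RealProj.affineVec_ne_zero i _
  have hηd : DifferentiableAt ℝ η 0 :=
    ((RealProj.contDiff_affineVec i).differentiable (by simp) _).comp (0 : ℝ) hd.differentiableAt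
  have hηγ : ∀ᶠ t in nhds (0 : ℝ), lineOf (η t) = γ t := by
    have hnear : ∀ᶠ t in nhds (0 : ℝ), γ t ∈ (RealProj.affineChart i).source :=
      hγ.continuous.continuousAt.eventually_mem
        ((RealProj.affineChart i).open_source.mem_nhds (hγ0 ▸ hxi))
    filter_upwards [hnear] with t ht using lineOf_affineVec_affineChart ht
  let κ : ℝ → R4 := fun t => K (η t)
  have hκd : DifferentiableAt ℝ κ 0 :=
    ((hHK.contDiffOn_inv.contDiffAt (isOpen_compl_singleton.mem_nhds (hη0 0))).differentiableAt
      (by simp)).comp (0 : ℝ) hηd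
  have hκ0 : ∀ t, κ t ≠ 0 := fun t => hHK.inv_map_ne_zero (hη0 t)
  obtain ⟨a, ha⟩ : ∃ a : ℝ, a • torusPt P = κ 0 := by
    refine (lineOf_eq_iff (hκ0 0) hPne).1 ?_
    rw [hKφ _ (hη0 0), hηγ.self_of_nhds, hγ0, φ.symm_apply_apply]
  have ha0 : a ≠ 0 := fun h => hκ0 0 (by rw [← ha, h, zero_smul])
  have ha' : (|a| : ℝ) ≠ 0 := abs_ne_zero.2 ha0
  have haC : (a : ℂ) ≠ 0 := by exact_mod_cast ha0
  -- the angles of the curve in the link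
  have hz0 : zCoord (κ 0) = a * Complex.exp (P.1 * Complex.I) := by
    rw [← ha, zCoord_smul, zCoord_torusPt]
  have hw0 : wCoord (κ 0) = a * Complex.exp (P.2 * Complex.I) := by
    rw [← ha, wCoord_smul, wCoord_torusPt]
  have hz0' : zCoord (κ 0) ≠ 0 := by rw [hz0]; exact mul_ne_zero haC (Complex.exp_ne_zero _)
  have hw0' : wCoord (κ 0) ≠ 0 := by rw [hw0]; exact mul_ne_zero haC (Complex.exp_ne_zero _)
  have hzn : ‖zCoord (κ 0)‖ = |a| := by
    rw [hz0, norm_mul, Complex.norm_exp_ofReal_mul_I, mul_one, Complex.norm_real, Real.norm_eq_abs]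
  have hwn : ‖wCoord (κ 0)‖ = |a| := by
    rw [hw0, norm_mul, Complex.norm_exp_ofReal_mul_I, mul_one, Complex.norm_real, Real.norm_eq_abs]
  have hzd : DifferentiableAt ℝ (fun t => zCoord (κ t)) 0 :=
    (differentiable_zCoord _).comp (0 : ℝ) hκd
  have hwd : DifferentiableAt ℝ (fun t => wCoord (κ t)) 0 :=
    (differentiable_wCoord _).comp (0 : ℝ) hκd
  let ρ₁ : ℝ → ℝ := fun t => P.1 + (zCoord (κ t) / zCoord (κ 0)).arg
  let ρ₂ : ℝ → ℝ := fun t => P.2 + (wCoord (κ t) / wCoord (κ 0)).arg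
  have hρ₁ : DifferentiableAt ℝ ρ₁ 0 :=
    (differentiableAt_arg (hzd.div_const _) (by simp [div_self hz0'])).const_add _
  have hρ₂ : DifferentiableAt ℝ ρ₂ 0 :=
    (differentiableAt_arg (hwd.div_const _) (by simp [div_self hw0'])).const_add _
  have hρ0 : (ρ₁ 0, ρ₂ 0) = P := by
    simp [ρ₁, ρ₂, div_self hz0', div_self hw0']
  let c : ℝ → ℝ := fun t => a * (‖zCoord (κ t)‖ / |a|)
  have hcd : DifferentiableAt ℝ c 0 := ((hzd.norm ℝ hz0').div_const _).const_mul _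
  have hlink : ∀ᶠ t in nhds (0 : ℝ), κ t = c t • torusPt (ρ₁ t, ρ₂ t) ∧
      OnLink p q (ρ₁ t, ρ₂ t) := by
    filter_upwards [hηγ] with t ht
    obtain ⟨y, hy, hyt⟩ := hγS t
    obtain ⟨P', hP', rfl⟩ := (mem_projTorusLink_iff h0).1 hy
    have h1 : lineOf (κ t) = lineOf (torusPt P') := by
      rw [hKφ _ (hη0 t), ht, ← hyt, φ.symm_apply_apply]
    obtain ⟨s, hs⟩ := (lineOf_eq_iff (hκ0 t) (torusPt_ne_zero P')).1 h1
    have h2 : ‖zCoord (κ t)‖ = ‖wCoord (κ t)‖ := by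
      rw [← hs, zCoord_smul, wCoord_smul, zCoord_torusPt, wCoord_torusPt, norm_mul, norm_mul,
        Complex.norm_exp_ofReal_mul_I, Complex.norm_exp_ofReal_mul_I]
    have key : ∀ (v v₀ : ℂ) (x : ℝ), v₀ = a * Complex.exp (x * Complex.I) → v₀ ≠ 0 →
        ‖v₀‖ = |a| → v = (a * (‖v‖ / |a|) : ℝ) *
          Complex.exp ((x + (v / v₀).arg : ℝ) * Complex.I) := by
      intro v v₀ x hv₀ hv₀0 hn
      have h3 := Complex.norm_mul_exp_arg_mul_I (v / v₀)
      rw [norm_div, hn] at h3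
      have h4 : v = v₀ * (v / v₀) := by field_simp
      have h5 : v = a * Complex.exp (x * Complex.I) * (((‖v‖ / |a| : ℝ) : ℂ) *
          Complex.exp ((v / v₀).arg * Complex.I)) := by rw [← hv₀, h3, ← h4]
      refine h5.trans ?_
      rw [Complex.ofReal_add, add_mul, Complex.exp_add]
      push_cast
      ring
    have h5 : κ t = c t • torusPt (ρ₁ t, ρ₂ t) := by
      apply ext_coord
      · rw [zCoord_smul, zCoord_torusPt]
        exact key _ _ _ hz0 hz0' hzn
      · rw [wCoord_smul, wCoord_torusPt]
        simp only [c, h2]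
        exact key _ _ _ hw0 hw0' hwn
    refine ⟨h5, ?_⟩
    have hc0 : c t ≠ 0 := fun h => hκ0 t (by rw [h5, h, zero_smul])
    refine (antipodalEq_of_lineOf_eq ?_).onLink hpq hP'
    rw [← h1, h5, lineOf_smul hc0]
  obtain ⟨r, hr, hline⟩ := hP.exists_eq_add_smul hq
  let D : ℝ × ℝ := ((q : ℝ), (p : ℝ))
  let τ : ℝ → ℝ := fun t => (ρ₁ t - P.1) / q
  have hτd : DifferentiableAt ℝ τ 0 := (hρ₁.sub_const _).div_const _
  have hρD : ∀ᶠ t in nhds (0 : ℝ), (ρ₁ t, ρ₂ t) = P + τ t • D := by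
    have hcont : ContinuousAt (fun t => (ρ₁ t, ρ₂ t)) 0 := hρ₁.continuousAt.prodMk hρ₂.continuousAt
    have hnear : ∀ᶠ t in nhds (0 : ℝ), (ρ₁ t, ρ₂ t) ∈ Metric.ball P r :=
      hcont.eventually_mem (by rw [hρ0]; exact Metric.ball_mem_nhds P hr)
    filter_upwards [hnear, hlink] with t ht hl
    obtain ⟨s, -, hs⟩ := hline _ hl.2 ht
    have h1 : ρ₁ t = P.1 + s * q := congrArg Prod.fst hs
    have h2 : τ t = s := by simp only [τ, h1]; field_simp; ring
    rw [h2, hs]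
  have hτ0 : P + τ 0 • D = P := by rw [← hρD.self_of_nhds, hρ0]
  -- the height function vanishes to second order along the curve
  have hf : HasDerivAt (fun t => heightFn H u (P + τ t • D)) 0 0 := by
    have h1 : HasFDerivAt (heightFn H u) (fderiv ℝ (heightFn H u) P) (P + τ 0 • D) := by
      rw [hτ0]
      exact ((hHK.contDiff_heightFn u).differentiable (by simp) P).hasFDerivAt
    have h2 : HasDerivAt (fun t => P + τ t • D) (deriv τ 0 • D) 0 :=
      (hτd.hasDerivAt.smul_const D).const_add P
    have h3 := h1.comp_hasDerivAt (0 : ℝ) h2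
    rwa [_root_.map_smul, show fderiv ℝ (heightFn H u) P D = 0 from hder, smul_zero] at h3
  have hprod := hcd.hasDerivAt.mul hf
  rw [hτ0, hP0, mul_zero, mul_zero, add_zero] at hprod
  have hη : HasDerivAt (fun t => (u i + inner ℝ (affineNormal i u)
      (RealProj.affineChart i (γ t)) : ℝ)) (inner ℝ (affineNormal i u) d) 0 :=
    (HasDerivAt.inner_const_left _ hd).const_add _
  refine hdn (hη.unique (hprod.congr_of_eventuallyEq ?_))
  filter_upwards [hlink, hρD] with t ht hD
  rw [← inner_affineVec, Pi.mul_apply, ← hD]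
  have h6 : H (κ t) = RealProj.affineVec i (RealProj.affineChart i (γ t)) := hHK.right_inv _
  rw [← h6, ht.1, hHK.map_smul, real_inner_smul_right]
  rfl

/-- A link isotopic to a torus link meets every transverse plane in at least `min |p| |q|`
points. -/
theorem min_natAbs_le_encard {p q : ℤ} (hpq : p ≡ q [ZMOD 2]) {L' P : Set (RealProj 3)}
    (hL : AreIsotopic (projTorusLink p q) L') (hP : IsProjPlane P) (htr : AreTransverse L' P) :
    ((min p.natAbs q.natAbs : ℕ) : ℕ∞) ≤ (L' ∩ P).encard := by
  by_cases hp : p = 0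
  · simp [hp]
  by_cases hq : q = 0
  · simp [hq]
  by_cases hfin : (L' ∩ P).Finite
  swap
  · rw [Set.not_finite.1 hfin |>.encard_eq]; exact le_top
  obtain ⟨φ, hφ, hφ0, rfl⟩ := hL
  obtain ⟨u, hu, rfl⟩ := exists_eq_planeOf hP
  obtain ⟨H, K, hHK, hHφ⟩ := exists_homogeneous_lift φ hφ hφ0
  have h0 : ¬(p = 0 ∧ q = 0) := fun h => hp h.1
  have := hHK.min_natAbs_le_card hp hq hpq
    (fun P hP hP0 => hHK.fderiv_heightFn_ne_zero (φ 1) hHφ hq hpq hu htr hP hP0)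
    hfin.toFinset (fun P => φ 1 (lineOf (torusPt P)))
    (fun P hP hP0 => by
      rw [Set.Finite.mem_toFinset]
      refine ⟨⟨_, (mem_projTorusLink_iff h0).2 ⟨P, hP, rfl⟩, rfl⟩, ?_⟩
      rw [← hHφ _ (torusPt_ne_zero P)]
      exact (lineOf_mem_planeOf (hHK.map_ne_zero (torusPt_ne_zero P))).2 hP0)
    (fun P P' h => antipodalEq_of_lineOf_eq (by
      rw [← (φ 1).symm_apply_apply (lineOf (torusPt P)), h, (φ 1).symm_apply_apply]))
  rw [hfin.encard_eq_coe_toFinset_card]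
  exact_mod_cast this

/-! ### Planes realising the minimum -/

theorem areIsotopic_refl (L : Set (RealProj 3)) : AreIsotopic L L :=
  ⟨fun _ => Diffeomorph.refl (𝓡 3) (RealProj 3) ∞, contMDiffOn_snd, fun _ => rfl, by simp⟩

theorem OnLink.add_smul {p q : ℤ} {P : ℝ × ℝ} (h : OnLink p q P) (t : ℝ) :
    OnLink p q (P + t • ((q : ℝ), (p : ℝ))) := by
  obtain ⟨k, hk⟩ := h
  refine ⟨k, ?_⟩
  simp only [Prod.fst_add, Prod.snd_add, Prod.smul_fst, Prod.smul_snd, smul_eq_mul]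
  linarith

/-- A plane that the torus link itself crosses with nonzero speed bounds the plane section
number: `g` enumerates the crossings up to the identifications made by passing from angles to
points of projective space. -/
theorem planeSectionNumber_le {p q : ℤ} (h0 : ¬(p = 0 ∧ q = 0)) {u : R4} (hu : u ≠ 0)
    (htr : ∀ P, OnLink p q P → inner ℝ u (torusPt P) = (0 : ℝ) →
      deriv (fun t : ℝ => (inner ℝ u (torusPt (P + t • ((q : ℝ), (p : ℝ)))) : ℝ)) 0 ≠ 0)
    (n : ℕ) (g : ℕ → ℝ × ℝ)
    (hg : ∀ P, OnLink p q P → inner ℝ u (torusPt P) = (0 : ℝ) →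
      ∃ k < n, AntipodalEq (g k) P) :
    planeSectionNumber (projTorusLink p q) ≤ n := by
  have hmem : ∀ x ∈ projTorusLink p q ∩ planeOf u,
      ∃ P, OnLink p q P ∧ lineOf (torusPt P) = x ∧ inner ℝ u (torusPt P) = (0 : ℝ) := by
    rintro x ⟨hx, hxu⟩
    obtain ⟨P, hP, rfl⟩ := (mem_projTorusLink_iff h0).1 hx
    exact ⟨P, hP, rfl, (lineOf_mem_planeOf (torusPt_ne_zero P)).1 hxu⟩
  have hsub : projTorusLink p q ∩ planeOf u ⊆
      (fun k => lineOf (torusPt (g k))) '' (Finset.range n : Set ℕ) := by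
    intro x hx
    obtain ⟨P, hP, rfl, hPu⟩ := hmem x hx
    obtain ⟨k, hk, h⟩ := hg P hP hPu
    exact ⟨k, by simpa using hk, h.lineOf_eq.symm⟩
  have hcard : (projTorusLink p q ∩ planeOf u).encard ≤ n :=
    ((Set.encard_le_encard hsub).trans (Set.encard_image_le _ _)).trans
      (by rw [Set.encard_coe_eq_coe_finsetCard, Finset.card_range])
  suffices h : AreTransverse (projTorusLink p q) (planeOf u) by
    have hle : planeSectionNumber (projTorusLink p q) ≤ (projTorusLink p q ∩ planeOf u).encard :=
      sInf_le ⟨_, _, areIsotopic_refl _, isProjPlane_planeOf hu, h, rfl⟩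
    exact hle.trans hcard
  refine areTransverse_planeOf fun x hx => ?_
  obtain ⟨P, hP, hPx, hPu⟩ := hmem x hx
  refine ⟨fun t => torusPt (P + t • ((q : ℝ), (p : ℝ))), contDiff_torusPt.comp (by fun_prop),
    fun t => torusPt_ne_zero _, fun t => (mem_projTorusLink_iff h0).2 ⟨_, hP.add_smul t, rfl⟩,
    ?_, htr P hP hPu⟩
  simpa using hPx

theorem inner_torusPt (a b c d : ℝ) (P : ℝ × ℝ) : inner ℝ (!₂[a, b, c, d] : R4) (torusPt P) =
    a * Real.cos P.1 + b * Real.sin P.1 + (c * Real.cos P.2 + d * Real.sin P.2) := by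
  rw [PiLp.inner_apply, Fin.sum_univ_four]
  simp
  ring

/-- On the line `p x - q y ∈ 2πℤ`, the zeros of `cos x` form `|q|` classes modulo the
identifications of the torus. -/
theorem exists_of_cos_eq_zero {p q : ℤ} (hq : q ≠ 0) (hpq : p ≡ q [ZMOD 2]) {x y : ℝ} {k : ℤ}
    (h : p * x - q * y = 2 * Real.pi * k) (hx : Real.cos x = 0) :
    ∃ l < q.natAbs, ∃ i j : ℤ, 2 ∣ i - j ∧ x = Real.pi / 2 + Real.pi * i ∧
      y = (p * (Real.pi / 2) - 2 * Real.pi * (l : ℕ)) / q + Real.pi * j := by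
  obtain ⟨m, rfl⟩ := Real.cos_eq_zero_iff.1 hx
  obtain ⟨r, hr⟩ := hpq.symm.dvd
  set k₀ : ℤ := k - m * r with hk₀
  have hmod := Int.emod_nonneg k₀ hq
  have hlt := Int.emod_lt k₀ hq
  have hqR : (q : ℝ) ≠ 0 := by exact_mod_cast hq
  refine ⟨(k₀ % q).toNat, by omega, m, m - 2 * (k₀ / q), ⟨k₀ / q, by ring⟩, by ring, ?_⟩
  have h1 : (((k₀ % q).toNat : ℕ) : ℝ) = (k : ℝ) - m * r - q * (k₀ / q : ℤ) := by
    have h2 : (((k₀ % q).toNat : ℕ) : ℤ) = k - m * r - q * (k₀ / q) := by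
      rw [Int.toNat_of_nonneg hmod, Int.emod_def]
    exact_mod_cast h2
  have hr' : (p : ℝ) - q = 2 * r := by exact_mod_cast hr
  rw [h1]
  push_cast
  field_simp
  linear_combination -2 * h + 2 * Real.pi * m * hr'

theorem planeSectionNumber_le_right {p q : ℤ} (hq : q ≠ 0) (hpq : p ≡ q [ZMOD 2]) :
    planeSectionNumber (projTorusLink p q) ≤ q.natAbs := by
  have hin : ∀ P, inner ℝ (!₂[1, 0, 0, 0] : R4) (torusPt P) = Real.cos P.1 := fun P => by
    rw [inner_torusPt]; ring
  have hu : (!₂[1, 0, 0, 0] : R4) ≠ 0 := fun h => by simpa using congrArg (fun v : R4 => v 0) h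
  refine planeSectionNumber_le (fun h => hq h.2) hu ?_ _
    (fun l => (Real.pi / 2, (p * (Real.pi / 2) - 2 * Real.pi * (l : ℕ)) / q)) ?_
  · intro P _ hP
    rw [hin] at hP
    simp only [hin]
    have h1 : HasDerivAt (fun t : ℝ => Real.cos (P + t • ((q : ℝ), (p : ℝ))).1)
        (-Real.sin P.1 * q) 0 := by
      have h2 : HasDerivAt (fun t : ℝ => P.1 + t * q) q 0 := by
        simpa using ((hasDerivAt_id (0 : ℝ)).mul_const (q : ℝ)).const_add P.1
      simpa using h2.cos
    rw [h1.deriv]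
    have h3 : Real.sin P.1 ≠ 0 := fun h => by
      have := Real.sin_sq_add_cos_sq P.1
      simp [h, hP] at this
    exact mul_ne_zero (neg_ne_zero.2 h3) (by exact_mod_cast hq)
  · rintro P ⟨k, hk⟩ hP
    rw [hin] at hP
    obtain ⟨l, hl, i, j, hij, h1, h2⟩ := exists_of_cos_eq_zero hq hpq hk hP
    exact ⟨l, hl, i, j, hij, Prod.ext h1 h2⟩

theorem planeSectionNumber_le_left {p q : ℤ} (hp : p ≠ 0) (hpq : p ≡ q [ZMOD 2]) :
    planeSectionNumber (projTorusLink p q) ≤ p.natAbs := by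
  have hin : ∀ P, inner ℝ (!₂[0, 0, 1, 0] : R4) (torusPt P) = Real.cos P.2 := fun P => by
    rw [inner_torusPt]; ring
  have hu : (!₂[0, 0, 1, 0] : R4) ≠ 0 := fun h => by simpa using congrArg (fun v : R4 => v 2) h
  refine planeSectionNumber_le (fun h => hp h.1) hu ?_ _
    (fun l => ((q * (Real.pi / 2) - 2 * Real.pi * (l : ℕ)) / p, Real.pi / 2)) ?_
  · intro P _ hP
    rw [hin] at hP
    simp only [hin]
    have h1 : HasDerivAt (fun t : ℝ => Real.cos (P + t • ((q : ℝ), (p : ℝ))).2)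
        (-Real.sin P.2 * p) 0 := by
      have h2 : HasDerivAt (fun t : ℝ => P.2 + t * p) p 0 := by
        simpa using ((hasDerivAt_id (0 : ℝ)).mul_const (p : ℝ)).const_add P.2
      simpa using h2.cos
    rw [h1.deriv]
    have h3 : Real.sin P.2 ≠ 0 := fun h => by
      have := Real.sin_sq_add_cos_sq P.2
      simp [h, hP] at this
    exact mul_ne_zero (neg_ne_zero.2 h3) (by exact_mod_cast hp)
  · rintro P ⟨k, hk⟩ hP
    rw [hin] at hP
    have hk' : q * P.2 - p * P.1 = 2 * Real.pi * (-k : ℤ) := by push_cast; linarith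
    obtain ⟨l, hl, i, j, hij, h1, h2⟩ := exists_of_cos_eq_zero hp hpq.symm hk' hP
    exact ⟨l, hl, j, i, by omega, Prod.ext h2 h1⟩

theorem sin_pi_div_sub_ne_zero {p : ℤ} (hp : p ≠ 0) (h2 : 2 ∣ p) {x : ℝ} {k : ℤ}
    (h : p * x = 2 * Real.pi * k) : Real.sin (Real.pi / p - x) ≠ 0 := by
  intro hs
  obtain ⟨m, hm⟩ := Real.sin_eq_zero_iff.1 hs
  obtain ⟨r, rfl⟩ := h2
  have hp' : ((2 * r : ℤ) : ℝ) ≠ 0 := by exact_mod_cast hp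
  have h3 : Real.pi * (m * (2 * r) + 2 * k - 1) = 0 := by
    have h4 : (2 * r : ℤ) * (m * Real.pi) = Real.pi - (2 * r : ℤ) * x := by
      rw [hm]; field_simp
    push_cast at h4 h
    linear_combination h4 - h
  have h5 : ((m * (2 * r) + 2 * k - 1 : ℤ) : ℝ) = 0 := by
    push_cast
    exact (mul_eq_zero.1 h3).resolve_left Real.pi_ne_zero
  have h6 : 2 * (m * r + k) = 1 := by
    have : m * (2 * r) + 2 * k - 1 = 0 := by exact_mod_cast h5
    linear_combination this
  omega

theorem planeSectionNumber_zero_right {p : ℤ} (hp : p ≠ 0) (h2 : 2 ∣ p) :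
    planeSectionNumber (projTorusLink p 0) = 0 := by
  let u : R4 := !₂[Real.sin (Real.pi / p), -Real.cos (Real.pi / p), 0, 0]
  have hin : ∀ P, inner ℝ u (torusPt P) = Real.sin (Real.pi / p - P.1) := fun P => by
    rw [inner_torusPt, Real.sin_sub]; ring
  have hu : u ≠ 0 := fun h => by
    have := hin (Real.pi / p - Real.pi / 2, 0)
    simp [h] at this
  have hne : ∀ P, OnLink p 0 P → inner ℝ u (torusPt P) ≠ (0 : ℝ) := by
    rintro P ⟨k, hk⟩
    rw [hin]
    exact sin_pi_div_sub_ne_zero hp h2 (by simpa using hk)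
  simpa using planeSectionNumber_le (p := p) (q := 0) (fun h => hp h.1) hu
    (fun P hP h => absurd h (hne P hP)) 0 (fun _ => 0) (fun P hP h => absurd h (hne P hP))

theorem planeSectionNumber_zero_left {q : ℤ} (hq : q ≠ 0) (h2 : 2 ∣ q) :
    planeSectionNumber (projTorusLink 0 q) = 0 := by
  let u : R4 := !₂[0, 0, Real.sin (Real.pi / q), -Real.cos (Real.pi / q)]
  have hin : ∀ P, inner ℝ u (torusPt P) = Real.sin (Real.pi / q - P.2) := fun P => by
    rw [inner_torusPt, Real.sin_sub]; ring
  have hu : u ≠ 0 := fun h => by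
    have := hin (0, Real.pi / q - Real.pi / 2)
    simp [h] at this
  have hne : ∀ P, OnLink 0 q P → inner ℝ u (torusPt P) ≠ (0 : ℝ) := by
    rintro P ⟨k, hk⟩
    rw [hin]
    refine sin_pi_div_sub_ne_zero hq h2 (k := -k) ?_
    push_cast at hk ⊢
    linarith
  simpa using planeSectionNumber_le (p := 0) (q := q) (fun h => hq h.2) hu
    (fun P hP h => absurd h (hne P hP)) 0 (fun _ => 0) (fun P hP h => absurd h (hne P hP))

theorem planeSectionNumber_eq {p q : ℤ} (hpq : p ≡ q [ZMOD 2]) (h0 : ¬(p = 0 ∧ q = 0)) :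
    planeSectionNumber (projTorusLink p q) = ((min p.natAbs q.natAbs : ℕ) : ℕ∞) := by
  apply le_antisymm
  · by_cases hq : q = 0
    · subst hq
      rw [planeSectionNumber_zero_right (fun h => h0 ⟨h, rfl⟩)
        (Int.dvd_of_emod_eq_zero hpq)]
      exact zero_le
    by_cases hp : p = 0
    · subst hp
      rw [planeSectionNumber_zero_left hq (Int.dvd_of_emod_eq_zero hpq.symm)]
      exact zero_le
    rcases min_choice p.natAbs q.natAbs with h | h <;> rw [h]
    exacts [planeSectionNumber_le_left hp hpq, planeSectionNumber_le_right hq hpq]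
  · refine le_sInf ?_
    rintro _ ⟨L', P, hL, hP, htr, rfl⟩
    exact min_natAbs_le_encard hpq hL hP htr

end PlaneSection

end

theorem proposition1p1 (p q : ℤ) (hpq : p ≡ q [ZMOD 2]) (h0 : ¬(p = 0 ∧ q = 0)) :
    planeSectionNumber (projTorusLink p q) = ((min p.natAbs q.natAbs : ℕ) : ℕ∞) ∧
      (1 ≤ q → q ≤ p → planeSectionNumber (projTorusLink p q) = (q.toNat : ℕ∞)) := by
  refine ⟨PlaneSection.planeSectionNumber_eq hpq h0, fun h1 h2 => ?_⟩
  rw [PlaneSection.planeSectionNumber_eq hpq h0]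
  congr 1
  omega
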